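/- **Homotopy invariance of the index bundle.** Let $\mathbb K\in\{\mathbb R,\mathbb C\}$, let $X$ be a compact Hausdorff space and $I=[0,1]$. *Definitions.* Let $B$ be a compact Hausdorff space. A Banach bundle over $B$ is a locally trivial bundle of $\mathbb K$-vector spaces modelled on a Banach space, with norm-continuous transition functions. A morphism $L:\mathcal E\to\mathcal F$ of Banach bundles over $B$ is a family of bounded operators $L_\lambda:\mathcal E_\lambda\to\mathcal F_\lambda$, $\lambda\in B$, that is norm-continuous in local trivialisations; it is a Fredholm morphism if there is $k\in\mathbb Z$ such that every $L_\lambda$ is a bounded Fredholm operator of index $k$. A finite-dimensional subbundle $\mathcal V\subset\mathcal F$ is a family of subspaces $\mathcal V_\lambda\subset\mathcal F_\lambda$ whose union, with the subspace topology, is a finite-dimensional vector bundle over $B$; it is transversal to $\operatorname{im}L$ if $\operatorname{im}(L_\lambda)+\mathcal V_\lambda=\mathcal F_\lambda$ for all $\lambda\in B$. In that case let $E(L,\mathcal V)=\bigcup_{\lambda\in B}\{u\in\mathcal E_\lambda: L_\lambda u\in\mathcal V_\lambda\}$. Let $K(B)$ be the Grothendieck group of isomorphism classes of finite-dimensional $\mathbb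 K$-vector bundles over $B$ under direct sum (complex $K$-theory if $\mathbb K=\mathbb C$, and $KO(B)$ if $\mathbb K=\mathbb R$). The index bundle of a Fredholm morphism $L$ is $$\operatorname{ind}(L)=[E(L,\mathcal V)]-[\mathcal V]\in K(B),$$ where $\mathcal V\subset\mathcal F$ is any finite-dimensional subbundle transversal to $\operatorname{im}L$. *Statement.* Let $\mathcal E$ and $\mathcal F$ be Banach bundles over $X\times I$, let $L:\mathcal E\to\mathcal F$ be a Fredholm morphism, and let $i_0,i_1:X\to X\times I$ be given by $i_t(x)=(x,t)$. Then the index bundles of the pullbacks $i_0^*L:i_0^*\mathcal E\to i_0^*\mathcal F$ and $i_1^*L:i_1^*\mathcal E\to i_1^*\mathcal F$ are well defined (for $t=0,1$ a finite-dimensional subbundle transversal to $\operatorname{im}(i_t^*L)$ exists, and for every such subbundle $\mathcal V$ the family $E(i_t^*L,\mathcal V)$ is a finite-dimensional subbundle of $i_t^*\mathcal E$ and $[E(i_t^*L,\mathcal V)]-[\mathcal V]$ does not depend on $\mathcal V$), and $$\operatorname{ind}(i_0^*L)=\operatorname{ind}(i_1^*L)\in K(X).$$ -/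

import Mathlib

open Bundle Topology unitInterval

universe u v

/-! ### Finite-dimensional vector bundles and the group `K(X)` -/

section VectorBundles

variable {X : Type u} [TopologicalSpace X] (𝕜 : Type) [RCLike 𝕜]

/-- Local triviality of a family `E` of `𝕜`-vector spaces over `X`, with respect to the given
topology on its total space: the projection is continuous, and every point of `X` has an open
neighbourhood `U` over which the total space is homeomorphic to `U × 𝕜ⁿ` (for some `n`, which may
depend on the point) by a map over `U` that is a linear isomorphism on each fibre. -/
def IsLocallyTrivialFamily (E : X → Type v) [∀ x, AddCommGroup (E x)] [∀ x, Module 𝕜 (E x)]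
    [TopologicalSpace (TotalSpace Unit E)] : Prop :=
  Continuous (TotalSpace.proj : TotalSpace Unit E → X) ∧
  ∀ x : X, ∃ U : Set X, IsOpen U ∧ x ∈ U ∧ ∃ (n : ℕ) (Φ : ∀ y : U, E y ≃ₗ[𝕜] (Fin n → 𝕜)),
    Continuous (fun p : (TotalSpace.proj ⁻¹' U : Set (TotalSpace Unit E)) =>
      Φ ⟨p.1.proj, p.2⟩ p.1.snd) ∧
    Continuous (fun q : U × (Fin n → 𝕜) =>
      (⟨q.1, (Φ q.1).symm q.2⟩ : TotalSpace Unit E))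

variable (X) in
/-- A finite-dimensional `𝕜`-vector bundle over `X`; its rank is a locally constant function. -/
structure FDBundle where
  fiber : X → Type v
  [addCommGroup : ∀ x, AddCommGroup (fiber x)]
  [module : ∀ x, Module 𝕜 (fiber x)]
  [topology : TopologicalSpace (TotalSpace Unit fiber)]
  locallyTrivial : IsLocallyTrivialFamily 𝕜 fiber

attribute [instance] FDBundle.addCommGroup FDBundle.module FDBundle.topology

namespace FDBundle

variable {𝕜}

/-- Isomorphism of vector bundles over `X`: a homeomorphism of the total spaces over `X` which is
a linear isomorphism on each fibre. -/
def IsIso (A B : FDBundle.{u, v} X 𝕜) : Prop :=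
  ∃ φ : ∀ x, A.fiber x ≃ₗ[𝕜] B.fiber x,
    Continuous (fun p : TotalSpace Unit A.fiber =>
      (⟨p.proj, φ p.proj p.snd⟩ : TotalSpace Unit B.fiber)) ∧
    Continuous (fun p : TotalSpace Unit B.fiber =>
      (⟨p.proj, (φ p.proj).symm p.snd⟩ : TotalSpace Unit A.fiber))

theorem IsIso.refl (A : FDBundle.{u, v} X 𝕜) : A.IsIso A :=
  ⟨fun _ => LinearEquiv.refl 𝕜 _, continuous_id, continuous_id⟩

theorem IsIso.symm {A B : FDBundle.{u, v} X 𝕜} : A.IsIso B → B.IsIso A := fun ⟨φ, h, h'⟩ =>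
  ⟨fun x => (φ x).symm, h', h⟩

theorem IsIso.trans {A B C : FDBundle.{u, v} X 𝕜} : A.IsIso B → B.IsIso C → A.IsIso C :=
  fun ⟨φ, h, h'⟩ ⟨ψ, k, k'⟩ => ⟨fun x => (φ x).trans (ψ x), k.comp h, h'.comp k'⟩

/-- The fibre product topology on the total space of `x ↦ A x × B x`. -/
instance prodTopology (A B : FDBundle.{u, v} X 𝕜) :
    TopologicalSpace (TotalSpace Unit fun x => A.fiber x × B.fiber x) :=
  TopologicalSpace.induced
    (fun p => ((⟨p.proj, p.snd.1⟩ : TotalSpace Unit A.fiber),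
      (⟨p.proj, p.snd.2⟩ : TotalSpace Unit B.fiber))) inferInstance

theorem continuous_prod_fst (A B : FDBundle.{u, v} X 𝕜) :
    Continuous (fun p : TotalSpace Unit (fun x => A.fiber x × B.fiber x) =>
      (⟨p.proj, p.snd.1⟩ : TotalSpace Unit A.fiber)) := by
  let f := fun p : TotalSpace Unit (fun x => A.fiber x × B.fiber x) =>
    ((⟨p.proj, p.snd.1⟩ : TotalSpace Unit A.fiber), (⟨p.proj, p.snd.2⟩ : TotalSpace Unit B.fiber))
  have hf : Continuous f := continuous_induced_dom
  exact continuous_fst.comp hf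

theorem continuous_prod_snd (A B : FDBundle.{u, v} X 𝕜) :
    Continuous (fun p : TotalSpace Unit (fun x => A.fiber x × B.fiber x) =>
      (⟨p.proj, p.snd.2⟩ : TotalSpace Unit B.fiber)) := by
  let f := fun p : TotalSpace Unit (fun x => A.fiber x × B.fiber x) =>
    ((⟨p.proj, p.snd.1⟩ : TotalSpace Unit A.fiber), (⟨p.proj, p.snd.2⟩ : TotalSpace Unit B.fiber))
  have hf : Continuous f := continuous_induced_dom
  exact continuous_snd.comp hf

theorem continuous_prod_mk {T : Type*} [TopologicalSpace T] (A B : FDBundle.{u, v} X 𝕜)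
    {b : T → X} {f : ∀ t, A.fiber (b t)} {g : ∀ t, B.fiber (b t)}
    (hf : Continuous fun t => (⟨b t, f t⟩ : TotalSpace Unit A.fiber))
    (hg : Continuous fun t => (⟨b t, g t⟩ : TotalSpace Unit B.fiber)) :
    Continuous fun t =>
      (⟨b t, (f t, g t)⟩ : TotalSpace Unit fun x => A.fiber x × B.fiber x) :=
  continuous_induced_rng.2 (hf.prodMk hg)

theorem isLocallyTrivialFamily_prod (A B : FDBundle.{u, v} X 𝕜) :
    IsLocallyTrivialFamily 𝕜 fun x => A.fiber x × B.fiber x := by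
  refine ⟨A.locallyTrivial.1.comp (continuous_prod_fst A B), fun x => ?_⟩
  obtain ⟨U, hU, hxU, n, Φ, hΦ, hΦ'⟩ := A.locallyTrivial.2 x
  obtain ⟨V, hV, hxV, m, Ψ, hΨ, hΨ'⟩ := B.locallyTrivial.2 x
  let e : ((Fin n → 𝕜) × (Fin m → 𝕜)) ≃ₗ[𝕜] (Fin (n + m) → 𝕜) :=
    (LinearEquiv.sumArrowLequivProdArrow (Fin n) (Fin m) 𝕜 𝕜).symm.trans
      (LinearEquiv.funCongrLeft 𝕜 𝕜 finSumFinEquiv.symm)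
  have he : Continuous e := e.toLinearMap.continuous_of_finiteDimensional
  have he' : Continuous e.symm := e.symm.toLinearMap.continuous_of_finiteDimensional
  refine ⟨U ∩ V, hU.inter hV, ⟨hxU, hxV⟩, n + m,
    fun y => ((Φ ⟨y, y.2.1⟩).prodCongr (Ψ ⟨y, y.2.2⟩)).trans e, ?_, ?_⟩
  · refine he.comp (Continuous.prodMk ?_ ?_)
    · exact hΦ.comp (Continuous.subtype_mk
        ((continuous_prod_fst A B).comp continuous_subtype_val) fun p => p.2.1)
    · exact hΨ.comp (Continuous.subtype_mk
        ((continuous_prod_snd A B).comp continuous_subtype_val) fun p => p.2.2)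
  · refine continuous_prod_mk A B (b := fun q : ↑(U ∩ V) × (Fin (n + m) → 𝕜) => q.1.1) ?_ ?_
    · exact hΦ'.comp (Continuous.prodMk
        (Continuous.subtype_mk (continuous_subtype_val.comp continuous_fst) fun q => q.1.2.1)
        (continuous_fst.comp (he'.comp continuous_snd)))
    · exact hΨ'.comp (Continuous.prodMk
        (Continuous.subtype_mk (continuous_subtype_val.comp continuous_fst) fun q => q.1.2.2)
        (continuous_snd.comp (he'.comp continuous_snd)))

/-- The Whitney sum of two vector bundles. -/
def sum (A B : FDBundle.{u, v} X 𝕜) : FDBundle.{u, v} X 𝕜 where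
  fiber x := A.fiber x × B.fiber x
  locallyTrivial := isLocallyTrivialFamily_prod A B

variable (X 𝕜) in
/-- The zero bundle; its total space is a copy of `X`. -/
def zero : FDBundle.{u, v} X 𝕜 where
  fiber _ := PUnit
  topology := TopologicalSpace.induced TotalSpace.proj inferInstance
  locallyTrivial := by
    let _ : TopologicalSpace (TotalSpace Unit fun _ : X => PUnit.{v + 1}) :=
      TopologicalSpace.induced TotalSpace.proj inferInstance
    refine ⟨continuous_induced_dom, fun x => ⟨Set.univ, isOpen_univ, trivial, 0,
      fun _ => 0, ?_, ?_⟩⟩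
    · exact continuous_of_const fun _ _ => Subsingleton.elim _ _
    · exact continuous_induced_rng.2 (continuous_subtype_val.comp continuous_fst)

variable (X 𝕜) in
/-- Isomorphism of vector bundles as an equivalence relation. -/
def isoSetoid : Setoid (FDBundle.{u, v} X 𝕜) where
  r := IsIso
  iseqv := ⟨IsIso.refl, IsIso.symm, IsIso.trans⟩

theorem IsIso.sum {A A' B B' : FDBundle.{u, v} X 𝕜} (h : A.IsIso A') (k : B.IsIso B') :
    (A.sum B).IsIso (A'.sum B') := by
  obtain ⟨φ, h, h'⟩ := h
  obtain ⟨ψ, k, k'⟩ := k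
  exact ⟨fun x => (φ x).prodCongr (ψ x),
    continuous_prod_mk A' B' (h.comp (continuous_prod_fst A B)) (k.comp (continuous_prod_snd A B)),
    continuous_prod_mk A B (h'.comp (continuous_prod_fst A' B'))
      (k'.comp (continuous_prod_snd A' B'))⟩

theorem sum_comm (A B : FDBundle.{u, v} X 𝕜) : (A.sum B).IsIso (B.sum A) :=
  ⟨fun _ => LinearEquiv.prodComm 𝕜 _ _,
    continuous_prod_mk B A (continuous_prod_snd A B) (continuous_prod_fst A B),
    continuous_prod_mk A B (continuous_prod_snd B A) (continuous_prod_fst B A)⟩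

theorem sum_assoc (A B C : FDBundle.{u, v} X 𝕜) :
    ((A.sum B).sum C).IsIso (A.sum (B.sum C)) := by
  refine ⟨fun x => LinearEquiv.prodAssoc 𝕜 _ _ _, ?_, ?_⟩
  · have h := continuous_prod_fst (A.sum B) C
    exact continuous_prod_mk A (B.sum C) ((continuous_prod_fst A B).comp h)
      (continuous_prod_mk B C ((continuous_prod_snd A B).comp h) (continuous_prod_snd (A.sum B) C))
  · have h := continuous_prod_snd A (B.sum C)
    exact continuous_prod_mk (A.sum B) C
      (continuous_prod_mk A B (continuous_prod_fst A (B.sum C)) ((continuous_prod_fst B C).comp h))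
      ((continuous_prod_snd B C).comp h)

theorem zero_sum (A : FDBundle.{u, v} X 𝕜) : ((zero X 𝕜).sum A).IsIso A := by
  refine ⟨fun x => (LinearEquiv.uniqueProd (M := A.fiber x) (M₂ := PUnit.{v + 1})), continuous_prod_snd (zero X 𝕜) A, ?_⟩
  exact continuous_prod_mk (zero X 𝕜) A
    (continuous_induced_rng.2 A.locallyTrivial.1) continuous_id

end FDBundle

variable (X)

/-- The set of isomorphism classes of finite-dimensional `𝕜`-vector bundles over `X`. -/
def VectClass : Type (max u (v + 1)) := Quotient (FDBundle.isoSetoid.{u, v} X 𝕜)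

variable {X 𝕜} in
/-- The isomorphism class of a bundle. -/
def VectClass.mk (A : FDBundle.{u, v} X 𝕜) : VectClass.{u, v} X 𝕜 :=
  Quotient.mk (FDBundle.isoSetoid X 𝕜) A

instance VectClass.instZero : Zero (VectClass.{u, v} X 𝕜) := ⟨VectClass.mk (FDBundle.zero X 𝕜)⟩

instance VectClass.instAdd : Add (VectClass.{u, v} X 𝕜) :=
  ⟨Quotient.map₂ FDBundle.sum fun _ _ h _ _ k => FDBundle.IsIso.sum h k⟩

/-- Isomorphism classes of vector bundles form a commutative monoid under Whitney sum. -/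
instance VectClass.addCommMonoid : AddCommMonoid (VectClass.{u, v} X 𝕜) where
  add_assoc := by
    rintro ⟨A⟩ ⟨B⟩ ⟨C⟩
    exact Quotient.sound (FDBundle.sum_assoc A B C)
  zero_add := by
    rintro ⟨A⟩
    exact Quotient.sound (FDBundle.zero_sum A)
  add_zero := by
    rintro ⟨A⟩
    exact Quotient.sound ((FDBundle.sum_comm _ _).trans (FDBundle.zero_sum A))
  add_comm := by
    rintro ⟨A⟩ ⟨B⟩
    exact Quotient.sound (FDBundle.sum_comm A B)
  nsmul := nsmulRec

/-- The (complex or real, according to `𝕜`) topological K-group of `X`: the Grothendieck group of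
the monoid of isomorphism classes of finite-dimensional vector bundles over `X`. -/
abbrev KGroup : Type (max u (v + 1)) := Algebra.GrothendieckAddGroup (VectClass.{u, v} X 𝕜)

variable {X 𝕜} in
/-- The class `[A]` of a vector bundle in the K-group. -/
noncomputable def KGroup.ofBundle (A : FDBundle.{u, v} X 𝕜) : KGroup.{u, v} X 𝕜 :=
  Algebra.GrothendieckAddGroup.of (VectClass.mk A)

end VectorBundles

/-! ### Fredholm morphisms of Banach bundles and their index bundle

A Banach bundle over `B` with model (Banach) space `E` is a family `𝓔 : B → Type v` with
`[FiberBundle E 𝓔] [VectorBundle 𝕜 E 𝓔]`. -/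

section BanachBundles

variable {B : Type u} [TopologicalSpace B] {𝕜 : Type} [RCLike 𝕜]

section Subbundle

variable {E : Type*} [NormedAddCommGroup E] [NormedSpace 𝕜 E] (𝓔 : B → Type v)
  [∀ x, AddCommGroup (𝓔 x)] [∀ x, Module 𝕜 (𝓔 x)] [TopologicalSpace (TotalSpace E 𝓔)]

variable (E) {𝓔} in
/-- The subspace topology on the total space `⋃ₓ S x ⊆ 𝓔` of a family of subspaces of the fibres
of `𝓔`. -/
abbrev subfamilyTopology (S : ∀ x, Submodule 𝕜 (𝓔 x)) :
    TopologicalSpace (TotalSpace Unit fun x => S x) :=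
  TopologicalSpace.induced
    (fun p => (⟨p.proj, (p.snd : 𝓔 p.proj)⟩ : TotalSpace E 𝓔)) inferInstance

variable (E) {𝓔} in
/-- A family of subspaces of the fibres of `𝓔` is a finite-dimensional subbundle if its total
space, with the subspace topology, is a finite-dimensional vector bundle. -/
def IsFDSubbundle (S : ∀ x, Submodule 𝕜 (𝓔 x)) : Prop :=
  letI := subfamilyTopology E S
  IsLocallyTrivialFamily 𝕜 fun x => S x

variable (E 𝕜) in
/-- A finite-dimensional subbundle of a Banach bundle. -/
structure FDSubbundle where
  carrier : ∀ x, Submodule 𝕜 (𝓔 x)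
  isFDSubbundle : IsFDSubbundle E carrier

/-- A finite-dimensional subbundle, as a vector bundle in its own right. -/
def FDSubbundle.toBundle {𝓔 : B → Type v}
    [∀ x, AddCommGroup (𝓔 x)] [∀ x, Module 𝕜 (𝓔 x)] [TopologicalSpace (TotalSpace E 𝓔)]
    (V : FDSubbundle 𝕜 E 𝓔) : FDBundle.{u, v} B 𝕜 :=
  letI := subfamilyTopology E V.carrier
  { fiber := fun x => V.carrier x
    locallyTrivial := V.isFDSubbundle }

end Subbundle

section Morphism

variable (𝕜)
  (E : Type*) [NormedAddCommGroup E] [NormedSpace 𝕜 E] (𝓔 : B → Type v)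
  [∀ x, AddCommGroup (𝓔 x)] [∀ x, Module 𝕜 (𝓔 x)] [TopologicalSpace (TotalSpace E 𝓔)]
  [∀ x, TopologicalSpace (𝓔 x)] [FiberBundle E 𝓔] [VectorBundle 𝕜 E 𝓔]
  (F : Type*) [NormedAddCommGroup F] [NormedSpace 𝕜 F] (𝓕 : B → Type v)
  [∀ x, AddCommGroup (𝓕 x)] [∀ x, Module 𝕜 (𝓕 x)] [TopologicalSpace (TotalSpace F 𝓕)]
  [∀ x, TopologicalSpace (𝓕 x)] [FiberBundle F 𝓕] [VectorBundle 𝕜 F 𝓕]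
  [∀ x, IsTopologicalAddGroup (𝓕 x)] [∀ x, ContinuousSMul 𝕜 (𝓕 x)]

/-- A morphism of Banach bundles: a continuous section of the bundle of bounded operators
`𝓔 x → 𝓕 x`, i.e. in local trivialisations a norm-continuous family of bounded operators. -/
structure BanachBundleHom where
  toFun : ∀ x, 𝓔 x →L[𝕜] 𝓕 x
  continuous_toFun : Continuous fun x =>
    (⟨x, toFun x⟩ : TotalSpace (E →L[𝕜] F) fun x => 𝓔 x →L[𝕜] 𝓕 x)

variable {𝕜 E 𝓔 F 𝓕}

/-- The index `dim ker - dim coker` of an operator. -/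
noncomputable def operatorIndex {M N : Type*} [AddCommGroup M] [Module 𝕜 M] [TopologicalSpace M]
    [AddCommGroup N] [Module 𝕜 N] [TopologicalSpace N] (T : M →L[𝕜] N) : ℤ :=
  (Module.finrank 𝕜 T.ker : ℤ) - (Module.finrank 𝕜 (N ⧸ T.range) : ℤ)

namespace BanachBundleHom

variable (L : BanachBundleHom 𝕜 E 𝓔 F 𝓕)

/-- The morphism is, in each fibre, a bounded Fredholm operator of index `k`. -/
def IsFredholmOfIndex (k : ℤ) : Prop :=
  ∀ x, (L.toFun x).IsFredholm ∧ operatorIndex (L.toFun x) = k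

/-- Fredholm morphisms. -/
def IsFredholm : Prop := ∃ k : ℤ, L.IsFredholmOfIndex k

/-- The finite-dimensional subbundle `V` of `𝓕` is transversal to the image of `L`. -/
def IsTransversal (V : FDSubbundle 𝕜 F 𝓕) : Prop :=
  ∀ x, (L.toFun x).range ⊔ V.carrier x = ⊤

/-- The family `E(L, V)` of the preimages of the fibres of `V`. -/
def preimage (V : FDSubbundle 𝕜 F 𝓕) (x : B) : Submodule 𝕜 (𝓔 x) :=
  (V.carrier x).comap (L.toFun x).toLinearMap

/-- `κ` is the index bundle of `L`: there is a finite-dimensional subbundle `V` of `𝓕`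
transversal to the image of `L`, and for each such `V` the family `E(L, V)` is a
finite-dimensional subbundle of `𝓔` with `κ = [E(L, V)] - [V]`. -/
def IsIndexBundle (κ : KGroup.{u, v} B 𝕜) : Prop :=
  (∃ V : FDSubbundle 𝕜 F 𝓕, L.IsTransversal V) ∧
  ∀ V : FDSubbundle 𝕜 F 𝓕, L.IsTransversal V →
    ∃ h : IsFDSubbundle E (L.preimage V),
      κ = KGroup.ofBundle (FDSubbundle.toBundle ⟨L.preimage V, h⟩) - KGroup.ofBundle V.toBundle

open Classical in
/-- The index bundle `ind L ∈ K(B)`: the element `[E(L, V)] - [V]` for any transversal `V` (it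
takes the value `0` if there is no well defined such element). -/
noncomputable def ind : KGroup.{u, v} B 𝕜 :=
  if h : ∃ κ, L.IsIndexBundle κ then h.choose else 0

end BanachBundleHom

end Morphism

section Pullback

variable {B' : Type*} [TopologicalSpace B']
  {E : Type*} [NormedAddCommGroup E] [NormedSpace 𝕜 E] {𝓔 : B → Type v}
  [∀ x, AddCommGroup (𝓔 x)] [∀ x, Module 𝕜 (𝓔 x)] [TopologicalSpace (TotalSpace E 𝓔)]
  [∀ x, TopologicalSpace (𝓔 x)] [FiberBundle E 𝓔] [VectorBundle 𝕜 E 𝓔]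
  {F : Type*} [NormedAddCommGroup F] [NormedSpace 𝕜 F] {𝓕 : B → Type v}
  [∀ x, AddCommGroup (𝓕 x)] [∀ x, Module 𝕜 (𝓕 x)] [TopologicalSpace (TotalSpace F 𝓕)]
  [∀ x, TopologicalSpace (𝓕 x)] [FiberBundle F 𝓕] [VectorBundle 𝕜 F 𝓕]
  [∀ x, IsTopologicalAddGroup (𝓕 x)] [∀ x, ContinuousSMul 𝕜 (𝓕 x)]

instance pullback_addCommGroup (f : B' → B) (x : B') : AddCommGroup ((f *ᵖ 𝓔) x) :=
  inferInstanceAs (AddCommGroup (𝓔 (f x)))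

instance pullback_isTopologicalAddGroup (f : B' → B) (x : B') :
    IsTopologicalAddGroup ((f *ᵖ 𝓕) x) :=
  inferInstanceAs (IsTopologicalAddGroup (𝓕 (f x)))

instance pullback_continuousSMul (f : B' → B) (x : B') : ContinuousSMul 𝕜 ((f *ᵖ 𝓕) x) :=
  inferInstanceAs (ContinuousSMul 𝕜 (𝓕 (f x)))

/-- An operator `𝓔 (f x) → 𝓕 (f x)`, seen as an operator between the fibres over `x` of the
pullback bundles. -/
def pullbackOperator (f : B' → B) (x : B') (T : 𝓔 (f x) →L[𝕜] 𝓕 (f x)) :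
    (f *ᵖ 𝓔) x →L[𝕜] (f *ᵖ 𝓕) x := T

/-- The pullback `f^* L : f^* 𝓔 → f^* 𝓕` of a morphism, `(f^* L)ₓ = L_{f x}`. -/
def BanachBundleHom.pullback (L : BanachBundleHom 𝕜 E 𝓔 F 𝓕) (f : C(B', B)) :
    BanachBundleHom 𝕜 E ((f : B' → B) *ᵖ 𝓔) F ((f : B' → B) *ᵖ 𝓕) where
  toFun x := pullbackOperator f x (L.toFun (f x))
  continuous_toFun := by
    refine continuous_iff_continuousAt.2 fun x₀ => ?_
    have h := ((continuousAt_hom_bundle _ _).1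
      (L.continuous_toFun.continuousAt (x := f x₀))).2
    have h' := ContinuousAt.comp (f := f) h f.continuous.continuousAt
    refine (continuousAt_hom_bundle _ _).2 ⟨continuousAt_id, ?_⟩
    have hE := f.continuous.continuousAt.preimage_mem_nhds
      ((trivializationAt E 𝓔 (f x₀)).open_baseSet.mem_nhds
        (mem_baseSet_trivializationAt E 𝓔 (f x₀)))
    have hF := f.continuous.continuousAt.preimage_mem_nhds
      ((trivializationAt F 𝓕 (f x₀)).open_baseSet.mem_nhds
        (mem_baseSet_trivializationAt F 𝓕 (f x₀)))
    refine h'.congr ?_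
    filter_upwards [hE, hF] with x hxE hxF
    ext v
    have hxE' : x ∈ (trivializationAt E ((f : B' → B) *ᵖ 𝓔) x₀).baseSet := hxE
    have hxF' : x ∈ (trivializationAt F ((f : B' → B) *ᵖ 𝓕) x₀).baseSet := hxF
    have key : (trivializationAt E ((f : B' → B) *ᵖ 𝓔) x₀).symm x v =
        (trivializationAt E 𝓔 (f x₀)).symm (f x) v := by
      have h₁ := (trivializationAt E ((f : B' → B) *ᵖ 𝓔) x₀).apply_mk_symm hxE' v
      have h₂ := (trivializationAt E 𝓔 (f x₀)).apply_mk_symm hxE v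
      have h₃ := congrArg Prod.snd h₁
      have h₄ := congrArg Prod.snd h₂
      exact ((trivializationAt E 𝓔 (f x₀)).linearEquivAt 𝕜 (f x) hxE).injective (h₃.trans h₄.symm)
    simp only [Function.comp_apply]
    rw [ContinuousLinearMap.inCoordinates_eq hxE hxF,
      ContinuousLinearMap.inCoordinates_eq hxE' hxF']
    change (trivializationAt F 𝓕 (f x₀) ⟨f x, L.toFun (f x)
        ((trivializationAt E 𝓔 (f x₀)).symm (f x) v)⟩).2 =
      (trivializationAt F 𝓕 (f x₀) ⟨f x, L.toFun (f x)
        ((trivializationAt E ((f : B' → B) *ᵖ 𝓔) x₀).symm x v)⟩).2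
    rw [key]

end Pullback

end BanachBundles

/-- The inclusion `x ↦ (x, t)` of `X` into `X × [0, 1]`. -/
def sliceInclusion (X : Type*) [TopologicalSpace X] (t : I) : C(X, X × I) where
  toFun x := (x, t)
  continuous_toFun := by fun_prop

section TotalSpaceContinuity

variable {B : Type u} [TopologicalSpace B] {𝕜 : Type} [RCLike 𝕜]
  {F : Type*} [NormedAddCommGroup F] [NormedSpace 𝕜 F] {𝓕 : B → Type v}
  [∀ x, AddCommGroup (𝓕 x)] [∀ x, Module 𝕜 (𝓕 x)] [TopologicalSpace (TotalSpace F 𝓕)]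
  [∀ x, TopologicalSpace (𝓕 x)] [FiberBundle F 𝓕] [VectorBundle 𝕜 F 𝓕]
  {T : Type*} [TopologicalSpace T] {b : T → B} {t₀ : T}

variable (𝕜) in
/-- Continuity of a map into the total space, read in a linear trivialization. -/
theorem continuousAt_totalSpace_iff_coord (e : Trivialization F (π F 𝓕)) [MemTrivializationAtlas e]
    {y : ∀ t, 𝓕 (b t)} (h : b t₀ ∈ e.baseSet) :
    ContinuousAt (fun t => (⟨b t, y t⟩ : TotalSpace F 𝓕)) t₀ ↔
      ContinuousAt b t₀ ∧ ContinuousAt (fun t => e.continuousLinearMapAt 𝕜 (b t) (y t)) t₀ := by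
  have := e.tendsto_nhds_iff (l := 𝓝 t₀) (f := fun t => (⟨b t, y t⟩ : TotalSpace F 𝓕))
    (z := ⟨b t₀, y t₀⟩) (e.mem_source.2 h)
  refine this.trans (and_congr_right fun hb => ?_)
  change ContinuousAt _ _ ↔ _
  refine continuousAt_congr ?_
  filter_upwards [hb (e.open_baseSet.mem_nhds h)] with t ht
  exact (e.continuousLinearMapAt_apply_of_mem (R := 𝕜) ht (y t)).symm

variable {y z : ∀ t, 𝓕 (b t)}

include 𝕜 in
theorem continuousAt_totalSpace_add
    (hy : ContinuousAt (fun t => (⟨b t, y t⟩ : TotalSpace F 𝓕)) t₀)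
    (hz : ContinuousAt (fun t => (⟨b t, z t⟩ : TotalSpace F 𝓕)) t₀) :
    ContinuousAt (fun t => (⟨b t, y t + z t⟩ : TotalSpace F 𝓕)) t₀ := by
  have h := mem_baseSet_trivializationAt F 𝓕 (b t₀)
  rw [continuousAt_totalSpace_iff_coord 𝕜 _ h] at *
  refine ⟨hy.1, ?_⟩
  simp only [map_add]
  exact hy.2.add hz.2

theorem continuousAt_totalSpace_smul {c : T → 𝕜} (hc : ContinuousAt c t₀)
    (hy : ContinuousAt (fun t => (⟨b t, y t⟩ : TotalSpace F 𝓕)) t₀) :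
    ContinuousAt (fun t => (⟨b t, c t • y t⟩ : TotalSpace F 𝓕)) t₀ := by
  have h := mem_baseSet_trivializationAt F 𝓕 (b t₀)
  rw [continuousAt_totalSpace_iff_coord 𝕜 _ h] at *
  refine ⟨hy.1, ?_⟩
  simp only [map_smul]
  exact hc.smul hy.2

include 𝕜 in
theorem continuousAt_totalSpace_sub
    (hy : ContinuousAt (fun t => (⟨b t, y t⟩ : TotalSpace F 𝓕)) t₀)
    (hz : ContinuousAt (fun t => (⟨b t, z t⟩ : TotalSpace F 𝓕)) t₀) :
    ContinuousAt (fun t => (⟨b t, y t - z t⟩ : TotalSpace F 𝓕)) t₀ := by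
  have h := mem_baseSet_trivializationAt F 𝓕 (b t₀)
  rw [continuousAt_totalSpace_iff_coord 𝕜 _ h] at *
  refine ⟨hy.1, ?_⟩
  simp only [map_sub]
  exact hy.2.sub hz.2

include 𝕜 in
theorem continuousAt_totalSpace_zero (hb : ContinuousAt b t₀) :
    ContinuousAt (fun t => (⟨b t, 0⟩ : TotalSpace F 𝓕)) t₀ := by
  have h := mem_baseSet_trivializationAt F 𝓕 (b t₀)
  rw [continuousAt_totalSpace_iff_coord 𝕜 _ h] at *
  refine ⟨hb, ?_⟩
  simp only [map_zero]
  exact continuousAt_const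

theorem continuousAt_totalSpace_sum_smul {ι : Type*} (s : Finset ι) {c : ι → T → 𝕜}
    {g : ι → ∀ t, 𝓕 (b t)} (hb : ContinuousAt b t₀) (hc : ∀ i ∈ s, ContinuousAt (c i) t₀)
    (hg : ∀ i ∈ s, ContinuousAt (fun t => (⟨b t, g i t⟩ : TotalSpace F 𝓕)) t₀) :
    ContinuousAt (fun t => (⟨b t, ∑ i ∈ s, c i t • g i t⟩ : TotalSpace F 𝓕)) t₀ := by
  have h := mem_baseSet_trivializationAt F 𝓕 (b t₀)
  rw [continuousAt_totalSpace_iff_coord 𝕜 _ h]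
  refine ⟨hb, ?_⟩
  simp only [map_sum, map_smul]
  exact tendsto_finsetSum _ fun i hi => (hc i hi).smul
    ((continuousAt_totalSpace_iff_coord 𝕜 _ h).1 (hg i hi)).2

theorem continuousAt_totalSpace_symmL (e : Trivialization F (π F 𝓕)) [MemTrivializationAtlas e]
    {w : T → F} (h : b t₀ ∈ e.baseSet) (hb : ContinuousAt b t₀) (hw : ContinuousAt w t₀) :
    ContinuousAt (fun t => (⟨b t, e.symmL 𝕜 (b t) (w t)⟩ : TotalSpace F 𝓕)) t₀ := by
  rw [continuousAt_totalSpace_iff_coord 𝕜 e h]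
  refine ⟨hb, hw.congr ?_⟩
  filter_upwards [hb (e.open_baseSet.mem_nhds h)] with t ht
  rw [e.continuousLinearMapAt_symmL ht]

theorem ker_continuousLinearMapAt_eq_bot (e : Trivialization F (π F 𝓕)) [MemTrivializationAtlas e]
    {x : B} (hx : x ∈ e.baseSet) : (e.continuousLinearMapAt 𝕜 x).toLinearMap.ker = ⊥ :=
  LinearMap.ker_eq_bot_of_injective fun y z h => by
    have h' := congrArg (e.symmL 𝕜 x) h
    simpa only [ContinuousLinearMap.coe_coe, e.symmL_continuousLinearMapAt hx] using h'

/-- Multiplying by a function supported in `U` makes a map that is continuous over `U`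
continuous. -/
theorem continuous_totalSpace_smul_of_tsupport {ρ : B → 𝕜} (hρ : Continuous ρ) {U : Set B}
    (hU : tsupport ρ ⊆ U) (hb : Continuous b)
    (hy : ∀ t, b t ∈ U → ContinuousAt (fun t => (⟨b t, y t⟩ : TotalSpace F 𝓕)) t) :
    Continuous (fun t => (⟨b t, ρ (b t) • y t⟩ : TotalSpace F 𝓕)) := by
  refine continuous_iff_continuousAt.2 fun t => ?_
  by_cases ht : b t ∈ tsupport ρ
  · exact continuousAt_totalSpace_smul (hρ.comp hb).continuousAt (hy t (hU ht))
  · refine (continuousAt_totalSpace_zero (𝕜 := 𝕜) hb.continuousAt).congr ?_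
    filter_upwards [hb.continuousAt.preimage_mem_nhds
      ((isClosed_tsupport ρ).isOpen_compl.mem_nhds ht)] with s hs
    simp [image_eq_zero_of_notMem_tsupport hs]

theorem exists_bump [NormalSpace B] [T1Space B] {x₀ : B} {U : Set B} (hU : U ∈ 𝓝 x₀) :
    ∃ ρ : B → ℝ, Continuous ρ ∧ (∀ x, 0 ≤ ρ x) ∧ (∀ᶠ x in 𝓝 x₀, ρ x = 1) ∧ tsupport ρ ⊆ U := by
  obtain ⟨V, hV, hVc, hVU⟩ := exists_mem_nhds_isClosed_subset hU
  obtain ⟨W, hW, hWc, hWV⟩ := exists_mem_nhds_isClosed_subset (interior_mem_nhds.2 hV)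
  obtain ⟨f, hf0, hf1, hf⟩ := exists_continuous_zero_one_of_isClosed (s := (interior V)ᶜ) (t := W)
    isOpen_interior.isClosed_compl hWc
    (Set.disjoint_left.2 fun x hx hx' => hx (hWV hx'))
  refine ⟨f, f.continuous, fun x => (hf x).1, Filter.mem_of_superset hW fun x hx => hf1 hx, ?_⟩
  refine (closure_minimal ?_ hVc).trans hVU
  intro x hx
  by_contra h
  exact hx (hf0 fun h' => h (interior_subset h'))

end TotalSpaceContinuity

section Morphism

variable {B : Type u} [TopologicalSpace B] {𝕜 : Type} [RCLike 𝕜]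
  {E : Type*} [NormedAddCommGroup E] [NormedSpace 𝕜 E] {𝓔 : B → Type v}
  [∀ x, AddCommGroup (𝓔 x)] [∀ x, Module 𝕜 (𝓔 x)] [TopologicalSpace (TotalSpace E 𝓔)]
  [∀ x, TopologicalSpace (𝓔 x)] [FiberBundle E 𝓔] [VectorBundle 𝕜 E 𝓔]
  {F : Type*} [NormedAddCommGroup F] [NormedSpace 𝕜 F] {𝓕 : B → Type v}
  [∀ x, AddCommGroup (𝓕 x)] [∀ x, Module 𝕜 (𝓕 x)] [TopologicalSpace (TotalSpace F 𝓕)]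
  [∀ x, TopologicalSpace (𝓕 x)] [FiberBundle F 𝓕] [VectorBundle 𝕜 F 𝓕]
  [∀ x, IsTopologicalAddGroup (𝓕 x)] [∀ x, ContinuousSMul 𝕜 (𝓕 x)]

namespace BanachBundleHom

variable (L : BanachBundleHom 𝕜 E 𝓔 F 𝓕)

/-- A morphism read in trivializations of the two bundles. -/
noncomputable def inTriv (e : Trivialization E (π E 𝓔)) (f : Trivialization F (π F 𝓕))
    [MemTrivializationAtlas e] [MemTrivializationAtlas f] (x : B) : E →L[𝕜] F :=
  (f.continuousLinearMapAt 𝕜 x).comp ((L.toFun x).comp (e.symmL 𝕜 x))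

theorem continuousAt_inTriv (e : Trivialization E (π E 𝓔)) (f : Trivialization F (π F 𝓕))
    [MemTrivializationAtlas e] [MemTrivializationAtlas f] {x : B} (he : x ∈ e.baseSet)
    (hf : x ∈ f.baseSet) : ContinuousAt (L.inTriv e f) x :=
  ((((e.continuousLinearMap (RingHom.id 𝕜) f).continuousOn.continuousAt
    ((e.continuousLinearMap (RingHom.id 𝕜) f).open_source.mem_nhds
      ((e.continuousLinearMap (RingHom.id 𝕜) f).mem_source.2 ⟨he, hf⟩))).comp
    (f := fun x => (⟨x, L.toFun x⟩ : TotalSpace (E →L[𝕜] F) fun x => 𝓔 x →L[𝕜] 𝓕 x))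
      L.continuous_toFun.continuousAt).snd :)

theorem continuousAt_apply {T : Type*} [TopologicalSpace T] {b : T → B} {t₀ : T}
    {y : ∀ t, 𝓔 (b t)} (hy : ContinuousAt (fun t => (⟨b t, y t⟩ : TotalSpace E 𝓔)) t₀) :
    ContinuousAt (fun t => (⟨b t, L.toFun (b t) (y t)⟩ : TotalSpace F 𝓕)) t₀ := by
  have he := mem_baseSet_trivializationAt E 𝓔 (b t₀)
  have hf := mem_baseSet_trivializationAt F 𝓕 (b t₀)
  rw [continuousAt_totalSpace_iff_coord 𝕜 _ he] at hy
  rw [continuousAt_totalSpace_iff_coord 𝕜 _ hf]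
  refine ⟨hy.1, (((L.continuousAt_inTriv _ _ he hf).comp hy.1).clm_apply hy.2).congr ?_⟩
  filter_upwards [hy.1 ((trivializationAt E 𝓔 (b t₀)).open_baseSet.mem_nhds he)] with t ht
  change (trivializationAt F 𝓕 (b t₀)).continuousLinearMapAt 𝕜 (b t) (L.toFun (b t)
    ((trivializationAt E 𝓔 (b t₀)).symmL 𝕜 (b t)
      ((trivializationAt E 𝓔 (b t₀)).continuousLinearMapAt 𝕜 (b t) (y t)))) = _
  rw [Trivialization.symmL_continuousLinearMapAt _ ht]

theorem continuous_apply {T : Type*} [TopologicalSpace T] {b : T → B}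
    {y : ∀ t, 𝓔 (b t)} (hy : Continuous (fun t => (⟨b t, y t⟩ : TotalSpace E 𝓔))) :
    Continuous (fun t => (⟨b t, L.toFun (b t) (y t)⟩ : TotalSpace F 𝓕)) :=
  continuous_iff_continuousAt.2 fun _ => L.continuousAt_apply hy.continuousAt

end BanachBundleHom

end Morphism

section Coordinates

variable {𝕜 : Type*} [RCLike 𝕜] {M : Type*} [NormedAddCommGroup M] [NormedSpace 𝕜 M]

/-- Near a linearly independent tuple, coordinates with respect to a tuple can be read off by
operators depending continuously on the tuple. -/
theorem LinearIndependent.exists_coordinates {n : ℕ} {v₀ : Fin n → M}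
    (h : LinearIndependent 𝕜 v₀) :
    ∃ C : (Fin n → M) → M →L[𝕜] (Fin n → 𝕜), ∀ᶠ v in 𝓝 v₀,
      ContinuousAt C v ∧ ∀ a : Fin n → 𝕜, C v (∑ i, a i • v i) = a := by
  obtain ⟨P, hP⟩ : ∃ P : M →L[𝕜] (Fin n → 𝕜), ∀ a : Fin n → 𝕜, P (∑ i, a i • v₀ i) = a := by
    let S := Submodule.span 𝕜 (Set.range v₀)
    have : FiniteDimensional 𝕜 S := FiniteDimensional.span_of_finite 𝕜 (Set.finite_range v₀)
    let f : S →L[𝕜] (Fin n → 𝕜) := (Module.Basis.span h).equivFun.toLinearMap.toContinuousLinearMap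
    obtain ⟨P, hP⟩ := f.exist_extension_of_finiteDimensional_range
    refine ⟨P, fun a => ?_⟩
    have hmem : ∑ i, a i • v₀ i ∈ S :=
      Submodule.sum_mem _ fun i _ => S.smul_mem _ (Submodule.subset_span ⟨i, rfl⟩)
    have h1 : f ⟨_, hmem⟩ = P (∑ i, a i • v₀ i) := DFunLike.congr_fun hP _
    rw [← h1]
    have h2 : (⟨∑ i, a i • v₀ i, hmem⟩ : S) = (Module.Basis.span h).equivFun.symm a := by
      apply Subtype.ext
      simp [Module.Basis.equivFun_symm_apply, Module.Basis.span_apply]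
    rw [h2]
    exact LinearEquiv.apply_symm_apply _ _
  let J : (Fin n → M) → (Fin n → 𝕜) →L[𝕜] M := fun v =>
    ∑ i, (ContinuousLinearMap.proj (R := 𝕜) (φ := fun _ : Fin n => 𝕜) i).smulRight (v i)
  have hJ : Continuous J := by
    refine continuous_finsetSum _ fun i _ => ?_
    exact ((ContinuousLinearMap.smulRightL 𝕜 (Fin n → 𝕜) M
      (ContinuousLinearMap.proj (R := 𝕜) (φ := fun _ : Fin n => 𝕜) i)).continuous).comp
        (continuous_apply i)
  have hJa : ∀ v a, J v a = ∑ i, a i • v i := fun v a => by simp [J]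
  have hPJ : Continuous fun v => P.comp (J v) := continuous_const.clm_comp hJ
  have h0 : P.comp (J v₀) = 1 := by
    ext1 a
    rw [ContinuousLinearMap.comp_apply, hJa, hP]
    rfl
  refine ⟨fun v => (Ring.inverse (P.comp (J v))).comp P, ?_⟩
  have hu : ∀ᶠ v in 𝓝 v₀, IsUnit (P.comp (J v)) := by
    refine hPJ.continuousAt (Units.isOpen.mem_nhds ?_)
    change IsUnit (P.comp (J v₀))
    rw [h0]
    exact isUnit_one
  filter_upwards [hu] with v hv
  refine ⟨?_, fun a => ?_⟩
  · obtain ⟨w, hw⟩ := hv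
    have : ContinuousAt (fun v => Ring.inverse (P.comp (J v))) v := by
      refine ContinuousAt.comp (g := Ring.inverse) ?_ hPJ.continuousAt
      rw [← hw]
      exact NormedRing.inverse_continuousAt w
    exact this.clm_comp continuousAt_const
  · rw [← hJa]
    exact DFunLike.congr_fun (Ring.inverse_mul_cancel _ hv) a

end Coordinates

section Frames

variable {B : Type u} [TopologicalSpace B] {𝕜 : Type} [RCLike 𝕜]
  (F : Type*) [NormedAddCommGroup F] [NormedSpace 𝕜 F] {𝓕 : B → Type v}
  [∀ x, AddCommGroup (𝓕 x)] [∀ x, Module 𝕜 (𝓕 x)] [TopologicalSpace (TotalSpace F 𝓕)]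

/-- The sections `g i` form a frame of the family of subspaces `S` at `x`, and are continuous
there. -/
structure IsFrameAt (S : ∀ x, Submodule 𝕜 (𝓕 x)) {n : ℕ} (g : Fin n → ∀ x, 𝓕 x) (x : B) :
    Prop where
  continuousAt : ∀ i, ContinuousAt (fun x => (⟨x, g i x⟩ : TotalSpace F 𝓕)) x
  linearIndependent : LinearIndependent 𝕜 fun i => g i x
  span_eq : Submodule.span 𝕜 (Set.range fun i => g i x) = S x

variable {F}

omit [NormedAddCommGroup F] [NormedSpace 𝕜 F] in
theorem IsFDSubbundle.exists_frame {S : ∀ x, Submodule 𝕜 (𝓕 x)} (hS : IsFDSubbundle F S) (x₀ : B) :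
    ∃ (n : ℕ) (g : Fin n → ∀ x, 𝓕 x), ∀ᶠ x in 𝓝 x₀, IsFrameAt F S g x := by
  let _ := subfamilyTopology F S
  obtain ⟨U, hU, hx, n, Φ, -, hΦ⟩ := hS.2 x₀
  classical
  let g : Fin n → ∀ x, 𝓕 x := fun i x =>
    if h : x ∈ U then ((Φ ⟨x, h⟩).symm (Pi.single i 1) : 𝓕 x) else 0
  have hg : ∀ i x (h : x ∈ U), g i x = ((Φ ⟨x, h⟩).symm (Pi.single i 1) : 𝓕 x) :=
    fun i x h => dif_pos h
  have hgx : ∀ x (h : x ∈ U), (fun i => g i x) =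
      (S x).subtype ∘ (Φ ⟨x, h⟩).symm.toLinearMap ∘ Pi.basisFun 𝕜 (Fin n) := fun x h => by
    ext1 i
    simp [hg i x h]
  refine ⟨n, g, Filter.mem_of_superset (hU.mem_nhds hx) fun x hx => ⟨fun i => ?_, ?_, ?_⟩⟩
  · refine ContinuousOn.continuousAt (s := U) ?_ (hU.mem_nhds hx)
    rw [continuousOn_iff_continuous_domRestrict]
    have h1 : Continuous fun y : U => (⟨y, (Φ y).symm (Pi.single i 1)⟩ : TotalSpace Unit fun x => S x) :=
      hΦ.comp (continuous_id.prodMk continuous_const)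
    refine (continuous_induced_dom.comp h1).congr fun y => ?_
    simp [hg i y y.2]
  · rw [hgx x hx]
    exact ((Pi.basisFun 𝕜 (Fin n)).linearIndependent.map' (Φ ⟨x, hx⟩).symm.toLinearMap
      (Φ ⟨x, hx⟩).symm.ker).map' (S x).subtype (Submodule.ker_subtype _)
  · rw [hgx x hx, Set.range_comp, Set.range_comp, Submodule.span_image]
    have h1 := Submodule.span_image (Φ ⟨x, hx⟩).symm.toLinearMap
      (s := Set.range (Pi.basisFun 𝕜 (Fin n)))
    rw [(Pi.basisFun 𝕜 (Fin n)).span_eq, Submodule.map_top, LinearEquiv.range] at h1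
    exact (congrArg _ h1).trans (by simp)

variable [∀ x, TopologicalSpace (𝓕 x)] [FiberBundle F 𝓕] [VectorBundle 𝕜 F 𝓕]

theorem isFDSubbundle_of_exists_frame {S : ∀ x, Submodule 𝕜 (𝓕 x)}
    (hS : ∀ x₀, ∃ (n : ℕ) (g : Fin n → ∀ x, 𝓕 x), ∀ᶠ x in 𝓝 x₀, IsFrameAt F S g x) :
    IsFDSubbundle F S := by
  let _ := subfamilyTopology F S
  have hι : Continuous fun p : TotalSpace Unit (fun x => S x) =>
    (⟨p.proj, (p.snd : 𝓕 p.proj)⟩ : TotalSpace F 𝓕) := continuous_induced_dom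
  refine ⟨(FiberBundle.continuous_proj F 𝓕).comp hι, fun x₀ => ?_⟩
  obtain ⟨n, g, hg⟩ := hS x₀
  let e := trivializationAt F 𝓕 x₀
  have he : x₀ ∈ e.baseSet := mem_baseSet_trivializationAt F 𝓕 x₀
  let γ : B → Fin n → F := fun x i => e.continuousLinearMapAt 𝕜 x (g i x)
  have hγc : ∀ x ∈ e.baseSet, IsFrameAt F S g x → ContinuousAt γ x := fun x hx h =>
    continuousAt_pi.2 fun i => ((continuousAt_totalSpace_iff_coord 𝕜 e hx).1 (h.continuousAt i)).2
  have hγ : LinearIndependent 𝕜 (γ x₀) :=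
    hg.self_of_nhds.linearIndependent.map' (e.continuousLinearMapAt 𝕜 x₀).toLinearMap
      (ker_continuousLinearMapAt_eq_bot e he)
  obtain ⟨C, hC⟩ := hγ.exists_coordinates
  have hev : ∀ᶠ x in 𝓝 x₀, x ∈ e.baseSet ∧ IsFrameAt F S g x ∧ ContinuousAt C (γ x) ∧
      ∀ a : Fin n → 𝕜, C (γ x) (∑ i, a i • γ x i) = a := by
    filter_upwards [e.open_baseSet.mem_nhds he, hg,
      (hγc x₀ he hg.self_of_nhds).eventually hC] with x h1 h2 h3 using ⟨h1, h2, h3⟩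
  obtain ⟨U, hUs, hU, hxU⟩ := mem_nhds_iff.1 hev
  have hγC : ∀ y ∈ U, ∀ a : Fin n → 𝕜,
      C (γ y) (e.continuousLinearMapAt 𝕜 y (∑ i, a i • g i y)) = a := fun y hy a => by
    simpa [γ] using (hUs hy).2.2.2 a
  have hmem : ∀ y ∈ U, ∀ a : Fin n → 𝕜, ∑ i, a i • g i y ∈ S y := fun y hy a => by
    rw [← (hUs hy).2.1.span_eq]
    exact Submodule.sum_mem _ fun i _ => Submodule.smul_mem _ _ (Submodule.subset_span ⟨i, rfl⟩)
  let Φ : ∀ y : U, S y ≃ₗ[𝕜] (Fin n → 𝕜) := fun y =>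
    { toFun := fun s => C (γ y) (e.continuousLinearMapAt 𝕜 y s)
      map_add' := fun s s' => by simp
      map_smul' := fun c s => by simp
      invFun := fun a => ⟨∑ i, a i • g i y, hmem y y.2 a⟩
      left_inv := fun s => by
        have hs : (s : 𝓕 y) ∈ Submodule.span 𝕜 (Set.range fun i => g i y) := by
          rw [(hUs y.2).2.1.span_eq]
          exact s.2
        obtain ⟨a, ha⟩ := (Submodule.mem_span_range_iff_exists_fun 𝕜).1 hs
        apply Subtype.ext
        simp only
        rw [← ha, hγC y y.2]
      right_inv := fun a => hγC y y.2 a }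
  refine ⟨U, hU, hxU, n, Φ, ?_, ?_⟩
  · refine continuous_iff_continuousAt.2 fun p => ?_
    have h1 := (continuousAt_totalSpace_iff_coord 𝕜 e (t₀ := p)
      (b := fun p : (TotalSpace.proj ⁻¹' U : Set (TotalSpace Unit fun x => S x)) => p.1.proj)
      (y := fun p => (p.1.snd : 𝓕 p.1.proj)) (hUs p.2).1).1
        (hι.comp continuous_subtype_val).continuousAt
    have h2 : ContinuousAt (fun p : (TotalSpace.proj ⁻¹' U : Set (TotalSpace Unit fun x => S x)) =>
        C (γ p.1.proj)) p :=
      ContinuousAt.comp (g := C) (hUs p.2).2.2.1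
        (ContinuousAt.comp (g := γ) (hγc _ (hUs p.2).1 (hUs p.2).2.1) h1.1)
    exact h2.clm_apply h1.2
  · refine continuous_induced_rng.2 (continuous_iff_continuousAt.2 fun q => ?_)
    have hb : Continuous fun q : U × (Fin n → 𝕜) => (q.1 : B) := by fun_prop
    refine continuousAt_totalSpace_sum_smul (b := fun q : U × (Fin n → 𝕜) => (q.1 : B)) (t₀ := q)
      (Finset.univ : Finset (Fin n)) (c := fun i q => q.2 i) (g := fun i q => g i q.1)
      hb.continuousAt (fun i _ => Continuous.continuousAt (by fun_prop)) fun i _ => ?_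
    exact ContinuousAt.comp (f := fun q : U × (Fin n → 𝕜) => (q.1 : B))
      ((hUs q.1.2).2.1.continuousAt i) hb.continuousAt

end Frames

section LocalInverse

variable {𝕜 : Type*} [RCLike 𝕜] {M N : Type*} [NormedAddCommGroup M] [NormedSpace 𝕜 M]
  [NormedAddCommGroup N] [NormedSpace 𝕜 N] [CompleteSpace M] [CompleteSpace N]

/-- A surjective operator with finite-dimensional kernel can be completed, by a projection to the
kernel, to an isomorphism; the same projection works for all nearby operators, and the inverse
depends continuously on the operator. -/
theorem ContinuousLinearMap.exists_local_inverse (T₀ : M →L[𝕜] N) (hT : T₀.range = ⊤)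
    [FiniteDimensional 𝕜 T₀.ker] :
    ∃ (n : ℕ) (P : M →L[𝕜] (Fin n → 𝕜)) (R : (M →L[𝕜] N) → (N × (Fin n → 𝕜)) →L[𝕜] M),
      ∀ᶠ T in 𝓝 T₀, ContinuousAt R T ∧ (∀ m, R T (T m, P m) = m) ∧
        ∀ z, T (R T z) = z.1 ∧ P (R T z) = z.2 := by
  obtain ⟨p, hp⟩ := Submodule.ClosedComplemented.of_finiteDimensional (𝕜 := 𝕜) T₀.ker
  let φ : T₀.ker ≃L[𝕜] (Fin (Module.finrank 𝕜 T₀.ker) → 𝕜) :=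
    (Module.finBasis 𝕜 T₀.ker).equivFunL
  let P : M →L[𝕜] (Fin (Module.finrank 𝕜 T₀.ker) → 𝕜) := (φ : _ →L[𝕜] _).comp p
  have hP : P.range = ⊤ := LinearMap.range_eq_top.2 fun a =>
    ⟨(φ.symm a : M), by simp [P, hp]⟩
  have hPk : P.ker = p.ker := by
    ext m
    simp [P]
  have hc : IsCompl T₀.ker P.ker := by
    rw [hPk]
    exact LinearMap.isCompl_of_proj hp
  let e := ContinuousLinearMap.equivProdOfSurjectiveOfIsCompl T₀ P hT hP hc
  have he : (e : M →L[𝕜] N × (Fin (Module.finrank 𝕜 T₀.ker) → 𝕜)) = T₀.prod P := by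
    ext1 m
    rfl
  have hcont : Continuous fun T : M →L[𝕜] N => T.prod P :=
    (ContinuousLinearMap.prodₗᵢ 𝕜).continuous.comp (continuous_id.prodMk continuous_const)
  refine ⟨_, P, fun T => (T.prod P).inverse, ?_⟩
  have hev : ∀ᶠ T in 𝓝 T₀, T.prod P ∈ Set.range
      ((↑) : (M ≃L[𝕜] N × (Fin (Module.finrank 𝕜 T₀.ker) → 𝕜)) → M →L[𝕜] _) := by
    refine hcont.continuousAt ?_
    rw [← he]
    exact e.nhds
  filter_upwards [hev] with T hT
  have hi : (T.prod P).IsInvertible := hT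
  refine ⟨ContinuousAt.comp (g := ContinuousLinearMap.inverse)
    (hi.contDiffAt_map_inverse (n := 0)).continuousAt hcont.continuousAt, fun m => ?_, fun z => ?_⟩
  · exact hi.inverse_apply_self m
  · have := hi.self_apply_inverse z
    exact ⟨congrArg Prod.fst this, congrArg Prod.snd this⟩

end LocalInverse

section Augmented

variable {B : Type u} [TopologicalSpace B] {𝕜 : Type} [RCLike 𝕜]
  {E : Type*} [NormedAddCommGroup E] [NormedSpace 𝕜 E] {𝓔 : B → Type v}
  [∀ x, AddCommGroup (𝓔 x)] [∀ x, Module 𝕜 (𝓔 x)] [TopologicalSpace (TotalSpace E 𝓔)]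
  [∀ x, TopologicalSpace (𝓔 x)] [FiberBundle E 𝓔] [VectorBundle 𝕜 E 𝓔]
  {F : Type*} [NormedAddCommGroup F] [NormedSpace 𝕜 F] {𝓕 : B → Type v}
  [∀ x, AddCommGroup (𝓕 x)] [∀ x, Module 𝕜 (𝓕 x)] [TopologicalSpace (TotalSpace F 𝓕)]
  [∀ x, TopologicalSpace (𝓕 x)] [FiberBundle F 𝓕] [VectorBundle 𝕜 F 𝓕]
  [∀ x, IsTopologicalAddGroup (𝓕 x)] [∀ x, ContinuousSMul 𝕜 (𝓕 x)]
  {T : Type*} [TopologicalSpace T] {b : T → B} {t₀ : T}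

namespace BanachBundleHom

variable (L : BanachBundleHom 𝕜 E 𝓔 F 𝓕)

/-- The operator `(u, a) ↦ L u - ∑ aᵢ wᵢ`, read in trivializations. -/
noncomputable def augmented (e : Trivialization E (π E 𝓔)) (f : Trivialization F (π F 𝓕))
    [MemTrivializationAtlas e] [MemTrivializationAtlas f] (x : B) {ι : Type*} [Fintype ι] (w : ι → 𝓕 x) :
    E × (ι → 𝕜) →L[𝕜] F :=
  (L.inTriv e f x).comp (.fst 𝕜 E (ι → 𝕜)) -
    ∑ i, ((ContinuousLinearMap.proj (R := 𝕜) (φ := fun _ : ι => 𝕜) i).comp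
      (.snd 𝕜 E (ι → 𝕜))).smulRight (f.continuousLinearMapAt 𝕜 x (w i))

variable (e : Trivialization E (π E 𝓔)) (f : Trivialization F (π F 𝓕))
    [MemTrivializationAtlas e] [MemTrivializationAtlas f]

theorem augmented_apply (x : B) {ι : Type*} [Fintype ι] (w : ι → 𝓕 x) (u : E) (a : ι → 𝕜) :
    L.augmented e f x w (u, a) =
      f.continuousLinearMapAt 𝕜 x (L.toFun x (e.symmL 𝕜 x u) - ∑ i, a i • w i) := by
  rw [map_sub, map_sum]
  simp [augmented, inTriv]

theorem continuousAt_augmented {ι : Type*} [Fintype ι] {g : ι → ∀ t, 𝓕 (b t)} (he : b t₀ ∈ e.baseSet)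
    (hf : b t₀ ∈ f.baseSet) (hb : ContinuousAt b t₀)
    (hg : ∀ i, ContinuousAt (fun t => (⟨b t, g i t⟩ : TotalSpace F 𝓕)) t₀) :
    ContinuousAt (fun t => L.augmented e f (b t) fun i => g i t) t₀ := by
  refine ContinuousAt.sub (((L.continuousAt_inTriv e f he hf).comp hb).clm_comp
    continuousAt_const) (tendsto_finsetSum _ fun i _ => ?_)
  exact ((ContinuousLinearMap.smulRightL 𝕜 (E × (ι → 𝕜)) F
    _).continuous.continuousAt).comp ((continuousAt_totalSpace_iff_coord 𝕜 f hf).1 (hg i)).2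

theorem range_augmented {x : B} (he : x ∈ e.baseSet) (hf : x ∈ f.baseSet) {ι : Type*} [Fintype ι]
    (w : ι → 𝓕 x) :
    (L.augmented e f x w).range = ⊤ ↔
      (L.toFun x).range ⊔ Submodule.span 𝕜 (Set.range w) = ⊤ := by
  rw [LinearMap.range_eq_top, Submodule.eq_top_iff']
  constructor
  · intro h y
    obtain ⟨⟨u, a⟩, hua⟩ := h (f.continuousLinearMapAt 𝕜 x y)
    have h1 : L.toFun x (e.symmL 𝕜 x u) - ∑ i, a i • w i = y := by
      have h2 : f.continuousLinearMapAt 𝕜 x (L.toFun x (e.symmL 𝕜 x u) - ∑ i, a i • w i) =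
          f.continuousLinearMapAt 𝕜 x y := (L.augmented_apply e f x w u a).symm.trans hua
      rw [← f.symmL_continuousLinearMapAt (R := 𝕜) hf y, ← h2, f.symmL_continuousLinearMapAt hf]
    rw [← h1]
    exact Submodule.sub_mem _ (Submodule.mem_sup_left ⟨_, rfl⟩) (Submodule.mem_sup_right
      (Submodule.sum_mem _ fun i _ => Submodule.smul_mem _ _ (Submodule.subset_span ⟨i, rfl⟩)))
  · intro h y
    obtain ⟨-, ⟨u, rfl⟩, s, hs, hy⟩ := Submodule.mem_sup.1 (h (f.symmL 𝕜 x y))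
    obtain ⟨a, rfl⟩ := (Submodule.mem_span_range_iff_exists_fun 𝕜).1 hs
    refine ⟨(e.continuousLinearMapAt 𝕜 x u, -a), ?_⟩
    change L.augmented e f x w _ = y
    rw [augmented_apply, e.symmL_continuousLinearMapAt he]
    simp only [Pi.neg_apply, neg_smul, Finset.sum_neg_distrib, sub_neg_eq_add]
    rw [← f.continuousLinearMapAt_symmL (R := 𝕜) hf y, ← hy]
    rfl

theorem finiteDimensional_ker_augmented {x : B} (he : x ∈ e.baseSet) (hf : x ∈ f.baseSet) {ι : Type*} [Fintype ι]
    (w : ι → 𝓕 x) (hL : FiniteDimensional 𝕜 (L.toFun x).ker) :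
    FiniteDimensional 𝕜 (L.augmented e f x w).ker := by
  rw [← Submodule.fg_iff_finiteDimensional] at hL ⊢
  refine Submodule.fg_of_fg_map_of_fg_inf_ker (LinearMap.snd 𝕜 E (ι → 𝕜))
    (IsNoetherian.noetherian _) ?_
  have h1 := (hL.map (e.continuousLinearMapAt 𝕜 x).toLinearMap).map
    (LinearMap.inl 𝕜 E (ι → 𝕜))
  refine (congrArg Submodule.FG ?_).mp h1
  symm
  ext ⟨u, a⟩
  simp only [Submodule.mem_inf, LinearMap.mem_ker, LinearMap.snd_apply, Submodule.mem_map]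
  constructor
  · rintro ⟨h, rfl⟩
    refine ⟨u, ⟨e.symmL 𝕜 x u, ?_, e.continuousLinearMapAt_symmL he u⟩, rfl⟩
    have h2 := congrArg (f.symmL 𝕜 x) ((L.augmented_apply e f x w u 0).symm.trans h)
    rw [f.symmL_continuousLinearMapAt hf] at h2
    simpa using h2
  · rintro ⟨-, ⟨u', hu', rfl⟩, h⟩
    obtain ⟨rfl, rfl⟩ := Prod.ext_iff.1 h
    refine ⟨(L.augmented_apply e f x w _ 0).trans ?_, rfl⟩
    have h3 : e.symmL 𝕜 x (e.continuousLinearMapAt 𝕜 x u') = u' := e.symmL_continuousLinearMapAt he u'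
    change f.continuousLinearMapAt 𝕜 x (L.toFun x (e.symmL 𝕜 x (e.continuousLinearMapAt 𝕜 x u')) - _) = 0
    rw [h3, show L.toFun x u' = 0 from hu']
    simp

variable [CompleteSpace E] [CompleteSpace F]

theorem exists_local_inverse_augmented {ι : Type*} [Fintype ι] {g : ι → ∀ t, 𝓕 (b t)} (he : b t₀ ∈ e.baseSet)
    (hf : b t₀ ∈ f.baseSet) (hb : ContinuousAt b t₀)
    (hg : ∀ i, ContinuousAt (fun t => (⟨b t, g i t⟩ : TotalSpace F 𝓕)) t₀)
    (hL : FiniteDimensional 𝕜 (L.toFun (b t₀)).ker)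
    (hs : (L.toFun (b t₀)).range ⊔ Submodule.span 𝕜 (Set.range fun i => g i t₀) = ⊤) :
    ∃ (n : ℕ) (P : E × (ι → 𝕜) →L[𝕜] (Fin n → 𝕜))
      (R : T → (F × (Fin n → 𝕜)) →L[𝕜] E × (ι → 𝕜)), ∀ᶠ t in 𝓝 t₀,
      (ContinuousAt b t → (∀ i, ContinuousAt (fun t => (⟨b t, g i t⟩ : TotalSpace F 𝓕)) t) →
        ContinuousAt R t) ∧
      (∀ m, R t (L.augmented e f (b t) (fun i => g i t) m, P m) = m) ∧
      ∀ z, L.augmented e f (b t) (fun i => g i t) (R t z) = z.1 ∧ P (R t z) = z.2 := by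
  have := L.finiteDimensional_ker_augmented e f he hf (fun i => g i t₀) hL
  obtain ⟨n, P, R, h⟩ := (L.augmented e f (b t₀) fun i => g i t₀).exists_local_inverse
    ((L.range_augmented e f he hf _).2 hs)
  refine ⟨n, P, fun t => R (L.augmented e f (b t) fun i => g i t), ?_⟩
  filter_upwards [(L.continuousAt_augmented e f he hf hb hg).eventually h,
    hb (e.open_baseSet.mem_nhds he), hb (f.open_baseSet.mem_nhds hf)] with t ht h1 h2
  exact ⟨fun hb hg => ContinuousAt.comp (g := R) ht.1 (L.continuousAt_augmented e f h1 h2 hb hg),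
    ht.2⟩

/-- Transversality is an open condition. -/
theorem eventually_range_sup_span_eq_top {ι : Type*} [Fintype ι] {g : ι → ∀ t, 𝓕 (b t)}
    (hb : ContinuousAt b t₀)
    (hg : ∀ i, ContinuousAt (fun t => (⟨b t, g i t⟩ : TotalSpace F 𝓕)) t₀)
    (hL : FiniteDimensional 𝕜 (L.toFun (b t₀)).ker)
    (hs : (L.toFun (b t₀)).range ⊔ Submodule.span 𝕜 (Set.range fun i => g i t₀) = ⊤) :
    ∀ᶠ t in 𝓝 t₀,
      (L.toFun (b t)).range ⊔ Submodule.span 𝕜 (Set.range fun i => g i t) = ⊤ := by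
  have he := mem_baseSet_trivializationAt E 𝓔 (b t₀)
  have hf := mem_baseSet_trivializationAt F 𝓕 (b t₀)
  obtain ⟨n, P, R, h⟩ := L.exists_local_inverse_augmented _ _ he hf hb hg hL hs
  filter_upwards [h, hb ((trivializationAt E 𝓔 (b t₀)).open_baseSet.mem_nhds he),
    hb ((trivializationAt F 𝓕 (b t₀)).open_baseSet.mem_nhds hf)] with t ht h1 h2
  exact (L.range_augmented _ _ h1 h2 _).1
    (LinearMap.range_eq_top.2 fun y => ⟨_, (ht.2.2 (y, 0)).1⟩)

end BanachBundleHom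

end Augmented

section Preimage

variable {B : Type u} [TopologicalSpace B] {𝕜 : Type} [RCLike 𝕜]
  {E : Type*} [NormedAddCommGroup E] [NormedSpace 𝕜 E] {𝓔 : B → Type v}
  [∀ x, AddCommGroup (𝓔 x)] [∀ x, Module 𝕜 (𝓔 x)] [TopologicalSpace (TotalSpace E 𝓔)]
  [∀ x, TopologicalSpace (𝓔 x)] [FiberBundle E 𝓔] [VectorBundle 𝕜 E 𝓔]
  {F : Type*} [NormedAddCommGroup F] [NormedSpace 𝕜 F] {𝓕 : B → Type v}
  [∀ x, AddCommGroup (𝓕 x)] [∀ x, Module 𝕜 (𝓕 x)] [TopologicalSpace (TotalSpace F 𝓕)]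
  [∀ x, TopologicalSpace (𝓕 x)] [FiberBundle F 𝓕] [VectorBundle 𝕜 F 𝓕]
  [∀ x, IsTopologicalAddGroup (𝓕 x)] [∀ x, ContinuousSMul 𝕜 (𝓕 x)]
  [CompleteSpace E] [CompleteSpace F]

namespace BanachBundleHom

variable {L : BanachBundleHom 𝕜 E 𝓔 F 𝓕}

theorem isFDSubbundle_preimage (hL : ∀ x, FiniteDimensional 𝕜 (L.toFun x).ker)
    (V : FDSubbundle 𝕜 F 𝓕) (hV : L.IsTransversal V) : IsFDSubbundle E (L.preimage V) := by
  refine isFDSubbundle_of_exists_frame fun x₀ => ?_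
  obtain ⟨k, g, hg⟩ := V.isFDSubbundle.exists_frame x₀
  let e := trivializationAt E 𝓔 x₀
  let f := trivializationAt F 𝓕 x₀
  have he : x₀ ∈ e.baseSet := mem_baseSet_trivializationAt E 𝓔 x₀
  have hf : x₀ ∈ f.baseSet := mem_baseSet_trivializationAt F 𝓕 x₀
  obtain ⟨n, P, R, h⟩ := L.exists_local_inverse_augmented e f (b := id) (t₀ := x₀) (g := g) he hf
    continuousAt_id hg.self_of_nhds.continuousAt (hL x₀)
    (by rw [hg.self_of_nhds.span_eq]; exact hV x₀)
  refine ⟨n, fun j x => e.symmL 𝕜 x (R x (0, Pi.single j 1)).1, ?_⟩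
  filter_upwards [h, hg, e.open_baseSet.mem_nhds he, f.open_baseSet.mem_nhds hf] with
    x ⟨hRc, hRP, hR⟩ hgx hex hfx
  have hlin : ∀ c : Fin n → 𝕜,
      ∑ j, c j • e.symmL 𝕜 x (R x (0, Pi.single j 1)).1 = e.symmL 𝕜 x (R x (0, c)).1 := by
    intro c
    have h1 : ((0, c) : F × (Fin n → 𝕜)) = ∑ j, c j • ((0, Pi.single j 1) : F × (Fin n → 𝕜)) := by
      ext1
      · simp [Prod.fst_sum]
      · simp only [Prod.snd_sum, Prod.smul_snd]
        exact pi_eq_sum_univ' c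
    rw [h1, map_sum, Prod.fst_sum, map_sum]
    simp only [map_smul, Prod.smul_fst]
  have hker : ∀ c : Fin n → 𝕜,
      L.toFun x (e.symmL 𝕜 x (R x (0, c)).1) = ∑ i, (R x (0, c)).2 i • g i x := by
    intro c
    have h1 := congrArg (f.symmL 𝕜 x)
      ((L.augmented_apply e f x (fun i => g i x) _ _).symm.trans (hR (0, c)).1)
    rw [f.symmL_continuousLinearMapAt hfx, map_zero] at h1
    exact sub_eq_zero.1 h1
  refine ⟨fun j => ?_, ?_, le_antisymm ?_ ?_⟩
  · refine continuousAt_totalSpace_symmL (b := id) e hex continuousAt_id ?_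
    exact ((hRc continuousAt_id hgx.continuousAt).clm_apply continuousAt_const).fst
  · rw [Fintype.linearIndependent_iff]
    intro c hc
    rw [hlin] at hc
    have h1 := hker c
    rw [hc, map_zero] at h1
    have h2 : (R x (0, c)).2 = 0 :=
      funext (Fintype.linearIndependent_iff.1 hgx.linearIndependent _ h1.symm)
    have h3 : (R x (0, c)).1 = 0 := by
      rw [← e.continuousLinearMapAt_symmL (R := 𝕜) hex (R x (0, c)).1, hc, map_zero]
    have h4 := (hR (0, c)).2
    rw [show R x (0, c) = 0 from Prod.ext h3 h2, map_zero] at h4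
    exact fun i => (congrFun h4 i).symm
  · rw [Submodule.span_le]
    rintro - ⟨j, rfl⟩
    change L.toFun x _ ∈ V.carrier x
    rw [hker, ← hgx.span_eq]
    exact Submodule.sum_mem _ fun i _ => Submodule.smul_mem _ _ (Submodule.subset_span ⟨i, rfl⟩)
  · intro s hs
    have hs' : L.toFun x s ∈ V.carrier x := hs
    rw [← hgx.span_eq] at hs'
    obtain ⟨a, ha⟩ := (Submodule.mem_span_range_iff_exists_fun 𝕜).1 hs'
    have h1 : L.augmented e f x (fun i => g i x) (e.continuousLinearMapAt 𝕜 x s, a) = 0 := by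
      rw [augmented_apply, e.symmL_continuousLinearMapAt hex, ha, sub_self, map_zero]
    have h2 := hRP (e.continuousLinearMapAt 𝕜 x s, a)
    rw [show L.augmented e f (id x) (fun i => g i x) (e.continuousLinearMapAt 𝕜 x s, a) = 0 from h1]
      at h2
    refine (Submodule.mem_span_range_iff_exists_fun 𝕜).2
      ⟨P (e.continuousLinearMapAt 𝕜 x s, a), ?_⟩
    rw [hlin, h2, e.symmL_continuousLinearMapAt hex]

/-- Locally, a morphism transversal to `V` has a continuous right inverse modulo `V`. -/
theorem exists_local_rightInverse_mod (hL : ∀ x, FiniteDimensional 𝕜 (L.toFun x).ker)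
    (V : FDSubbundle 𝕜 F 𝓕) (hV : L.IsTransversal V) (x₀ : B) :
    ∃ r : ∀ x, 𝓕 x →ₗ[𝕜] 𝓔 x, ∀ᶠ x in 𝓝 x₀, (∀ y, L.toFun x (r x y) - y ∈ V.carrier x) ∧
      ∀ p : TotalSpace F 𝓕, p.proj = x →
        ContinuousAt (fun p : TotalSpace F 𝓕 => (⟨p.proj, r p.proj p.snd⟩ : TotalSpace E 𝓔)) p := by
  obtain ⟨k, g, hg⟩ := V.isFDSubbundle.exists_frame x₀
  let e := trivializationAt E 𝓔 x₀
  let f := trivializationAt F 𝓕 x₀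
  have he : x₀ ∈ e.baseSet := mem_baseSet_trivializationAt E 𝓔 x₀
  have hf : x₀ ∈ f.baseSet := mem_baseSet_trivializationAt F 𝓕 x₀
  obtain ⟨n, P, R, h⟩ := L.exists_local_inverse_augmented e f (b := id) (t₀ := x₀) (g := g) he hf
    continuousAt_id hg.self_of_nhds.continuousAt (hL x₀)
    (by rw [hg.self_of_nhds.span_eq]; exact hV x₀)
  refine ⟨fun x => (e.symmL 𝕜 x).toLinearMap ∘ₗ LinearMap.fst 𝕜 E (Fin k → 𝕜) ∘ₗ
    (R x).toLinearMap ∘ₗ LinearMap.inl 𝕜 F (Fin n → 𝕜) ∘ₗ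
      (f.continuousLinearMapAt 𝕜 x).toLinearMap, ?_⟩
  filter_upwards [h, hg, e.open_baseSet.mem_nhds he, f.open_baseSet.mem_nhds hf] with
    x ⟨hRc, hRP, hR⟩ hgx hex hfx
  refine ⟨fun y => ?_, ?_⟩
  · change L.toFun x (e.symmL 𝕜 x (R x (f.continuousLinearMapAt 𝕜 x y, 0)).1) - y ∈ V.carrier x
    have h1 := congrArg (f.symmL 𝕜 x) ((L.augmented_apply e f x (fun i => g i x)
      (R x (f.continuousLinearMapAt 𝕜 x y, 0)).1
      (R x (f.continuousLinearMapAt 𝕜 x y, 0)).2).symm.trans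
        (hR (f.continuousLinearMapAt 𝕜 x y, 0)).1)
    rw [f.symmL_continuousLinearMapAt hfx, f.symmL_continuousLinearMapAt hfx] at h1
    rw [sub_eq_iff_eq_add.2 (sub_eq_iff_eq_add'.1 h1), ← hgx.span_eq]
    exact Submodule.sum_mem _ fun i _ => Submodule.smul_mem _ _ (Submodule.subset_span ⟨i, rfl⟩)
  · rintro p rfl
    refine continuousAt_totalSpace_symmL e hex (FiberBundle.continuous_proj F 𝓕).continuousAt ?_
    have h1 := (continuousAt_totalSpace_iff_coord 𝕜 f (t₀ := p)
      (b := fun p : TotalSpace F 𝓕 => p.proj) (y := fun p => p.snd) hfx).1 continuousAt_id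
    exact (((hRc continuousAt_id hgx.continuousAt).comp (f := TotalSpace.proj) h1.1).clm_apply
      (h1.2.prodMk continuousAt_const)).fst

variable [CompactSpace B] [T2Space B]

/-- A morphism transversal to `V` has a continuous right inverse modulo `V`. -/
theorem exists_rightInverse_mod (hL : ∀ x, FiniteDimensional 𝕜 (L.toFun x).ker)
    (V : FDSubbundle 𝕜 F 𝓕) (hV : L.IsTransversal V) :
    ∃ r : ∀ x, 𝓕 x →ₗ[𝕜] 𝓔 x, (∀ x y, L.toFun x (r x y) - y ∈ V.carrier x) ∧
      Continuous fun p : TotalSpace F 𝓕 => (⟨p.proj, r p.proj p.snd⟩ : TotalSpace E 𝓔) := by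
  obtain ⟨w, hw, -, hw1, r, hr, hrc⟩ : ∃ w : B → ℝ, Continuous w ∧ (∀ x, 0 ≤ w x) ∧
      (∀ x ∈ Set.univ, 0 < w x) ∧ ∃ r : ∀ x, 𝓕 x →ₗ[𝕜] 𝓔 x,
        (∀ x y, L.toFun x (r x y) - (w x : 𝕜) • y ∈ V.carrier x) ∧
        Continuous fun p : TotalSpace F 𝓕 => (⟨p.proj, r p.proj p.snd⟩ : TotalSpace E 𝓔) := by
    refine isCompact_univ.induction_on (p := fun s => ∃ w : B → ℝ, Continuous w ∧ (∀ x, 0 ≤ w x) ∧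
      (∀ x ∈ s, 0 < w x) ∧ ∃ r : ∀ x, 𝓕 x →ₗ[𝕜] 𝓔 x,
        (∀ x y, L.toFun x (r x y) - (w x : 𝕜) • y ∈ V.carrier x) ∧
        Continuous fun p : TotalSpace F 𝓕 => (⟨p.proj, r p.proj p.snd⟩ : TotalSpace E 𝓔))
      ?_ ?_ ?_ ?_
    · refine ⟨0, continuous_const, fun _ => le_rfl, by simp, 0, by simp, ?_⟩
      exact continuous_iff_continuousAt.2 fun p => continuousAt_totalSpace_zero (𝕜 := 𝕜)
        (FiberBundle.continuous_proj F 𝓕).continuousAt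
    · rintro s t hst ⟨w, h1, h2, h3, h4⟩
      exact ⟨w, h1, h2, fun x hx => h3 x (hst hx), h4⟩
    · rintro s t ⟨w, h1, h2, h3, r, h4, h5⟩ ⟨w', h1', h2', h3', r', h4', h5'⟩
      refine ⟨w + w', h1.add h1', fun x => add_nonneg (h2 x) (h2' x), ?_, r + r', ?_, ?_⟩
      · rintro x (hx | hx)
        · exact add_pos_of_pos_of_nonneg (h3 x hx) (h2' x)
        · exact add_pos_of_nonneg_of_pos (h2 x) (h3' x hx)
      · intro x y
        convert (V.carrier x).add_mem (h4 x y) (h4' x y) using 1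
        simp only [Pi.add_apply, LinearMap.add_apply, map_add, add_smul]
        abel
      · exact continuous_iff_continuousAt.2 fun p =>
          continuousAt_totalSpace_add (𝕜 := 𝕜) h5.continuousAt h5'.continuousAt
    · intro x₀ _
      obtain ⟨r, hr⟩ := exists_local_rightInverse_mod hL V hV x₀
      obtain ⟨ρ, hρ, hρ0, hρ1, hρs⟩ := exists_bump hr
      refine ⟨_, mem_nhdsWithin_of_mem_nhds hρ1, ρ, hρ, hρ0, ?_, fun x => (ρ x : 𝕜) • r x, ?_, ?_⟩
      · intro x hx
        rw [show ρ x = 1 from hx]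
        exact one_pos
      · intro x y
        by_cases hx : x ∈ tsupport ρ
        · convert (V.carrier x).smul_mem (ρ x : 𝕜) ((hρs hx).1 y) using 1
          simp [smul_sub]
        · simp [image_eq_zero_of_notMem_tsupport hx]
      · refine continuous_totalSpace_smul_of_tsupport (ρ := fun x => (ρ x : 𝕜))
          (b := fun p : TotalSpace F 𝓕 => p.proj) (y := fun p => r p.proj p.snd)
          (RCLike.continuous_ofReal.comp hρ) (U := tsupport ρ) ?_
          (FiberBundle.continuous_proj F 𝓕) fun p hp => (hρs hp).2 p rfl
        exact closure_mono fun x hx h => hx (by simp [h])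
  refine ⟨fun x => ((w x : 𝕜)⁻¹) • r x, fun x y => ?_, ?_⟩
  · have hwx : (w x : 𝕜) ≠ 0 := RCLike.ofReal_ne_zero.2 (hw1 x trivial).ne'
    convert (V.carrier x).smul_mem (w x : 𝕜)⁻¹ (hr x y) using 1
    simp [smul_sub, smul_smul, hwx]
  · refine continuous_iff_continuousAt.2 fun p => ?_
    refine continuousAt_totalSpace_smul (c := fun p : TotalSpace F 𝓕 => (w p.proj : 𝕜)⁻¹) ?_
      hrc.continuousAt
    refine ContinuousAt.inv₀ ?_ (RCLike.ofReal_ne_zero.2 (hw1 _ trivial).ne')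
    exact (RCLike.continuous_ofReal.comp
      (hw.comp (FiberBundle.continuous_proj F 𝓕))).continuousAt

end BanachBundleHom

end Preimage

section Avoidance

variable {B : Type u} [TopologicalSpace B] {𝕜 : Type} [RCLike 𝕜]
  {F : Type*} [NormedAddCommGroup F] [NormedSpace 𝕜 F] {𝓕 : B → Type v}
  [∀ x, AddCommGroup (𝓕 x)] [∀ x, Module 𝕜 (𝓕 x)] [TopologicalSpace (TotalSpace F 𝓕)]
  [∀ x, TopologicalSpace (𝓕 x)] [FiberBundle F 𝓕] [VectorBundle 𝕜 F 𝓕]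

/-- In an infinite-dimensional Banach space, the complement of a continuous image of the product of
a compact space and a finite-dimensional space is dense. -/
theorem dense_compl_image_prod_of_infiniteDimensional [CompleteSpace F]
    (hF : ¬ FiniteDimensional 𝕜 F) {Y : Type*} [TopologicalSpace Y] {K : Set Y} (hK : IsCompact K)
    {n : ℕ} {φ : Y × (Fin n → 𝕜) → F} (hφ : ContinuousOn φ (K ×ˢ Set.univ)) :
    Dense (φ '' (K ×ˢ Set.univ))ᶜ := by
  have hC : ∀ m : ℕ, IsCompact (φ '' (K ×ˢ Metric.closedBall 0 m)) := fun m =>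
    (hK.prod (isCompact_closedBall _ _)).image_of_continuousOn
      (hφ.mono (Set.prod_mono le_rfl (Set.subset_univ _)))
  have h : Dense (⋂ m : ℕ, (φ '' (K ×ˢ Metric.closedBall 0 m))ᶜ) := by
    refine dense_iInter_of_isOpen_nat (fun m => (hC m).isClosed.isOpen_compl) fun m => ?_
    rw [← interior_eq_empty_iff_dense_compl, Set.eq_empty_iff_forall_notMem]
    intro w hw
    obtain ⟨ε, hε, hb⟩ := Metric.nhds_basis_closedBall.mem_iff.1 (mem_interior_iff_mem_nhds.1 hw)
    exact hF (.of_isCompact_closedBall 𝕜 hε ((hC m).of_isClosed_subset Metric.isClosed_closedBall hb))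
  refine h.mono ?_
  rw [← Set.compl_iUnion]
  refine Set.compl_subset_compl.2 ?_
  rintro - ⟨⟨y, a⟩, ⟨hy, -⟩, rfl⟩
  obtain ⟨m, hm⟩ := exists_nat_ge ‖a‖
  exact Set.mem_iUnion.2 ⟨m, _, ⟨hy, by simpa using hm⟩, rfl⟩

/-- Linear independence is an open condition. -/
theorem eventually_linearIndependent_totalSpace {T : Type*} [TopologicalSpace T] {b : T → B}
    {t₀ : T} {ι : Type*} [Finite ι] {g : ι → ∀ t, 𝓕 (b t)}
    (hg : ∀ i, ContinuousAt (fun t => (⟨b t, g i t⟩ : TotalSpace F 𝓕)) t₀)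
    (h : LinearIndependent 𝕜 fun i => g i t₀) :
    ∀ᶠ t in 𝓝 t₀, LinearIndependent 𝕜 fun i => g i t := by
  let e := trivializationAt F 𝓕 (b t₀)
  have he : b t₀ ∈ e.baseSet := mem_baseSet_trivializationAt F 𝓕 (b t₀)
  have h1 : ContinuousAt (fun t i => e.continuousLinearMapAt 𝕜 (b t) (g i t)) t₀ :=
    continuousAt_pi.2 fun i => ((continuousAt_totalSpace_iff_coord 𝕜 e he).1 (hg i)).2
  have h2 : LinearIndependent 𝕜 fun i => e.continuousLinearMapAt 𝕜 (b t₀) (g i t₀) :=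
    h.map' _ (ker_continuousLinearMapAt_eq_bot e he)
  filter_upwards [h1.eventually h2.eventually] with t ht
  exact ht.of_comp (e.continuousLinearMapAt 𝕜 (b t)).toLinearMap

theorem FDSubbundle.isOpen_compl (V : FDSubbundle 𝕜 F 𝓕) :
    IsOpen {p : TotalSpace F 𝓕 | p.snd ∉ V.carrier p.proj} := by
  refine isOpen_iff_mem_nhds.2 fun p hp => ?_
  obtain ⟨n, g, hg⟩ := V.isFDSubbundle.exists_frame p.proj
  have hproj := (FiberBundle.continuous_proj F 𝓕).continuousAt (x := p)
  have h := eventually_linearIndependent_totalSpace (𝕜 := 𝕜) (F := F) (t₀ := p)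
    (b := fun p : TotalSpace F 𝓕 => p.proj)
    (g := (Fin.cons (fun p : TotalSpace F 𝓕 => p.snd) fun i p => g i p.proj :
      Fin (n + 1) → ∀ p : TotalSpace F 𝓕, 𝓕 p.proj)) (fun i => ?_) ?_
  · filter_upwards [h, hproj.eventually hg] with q hq hgq
    have h1 : (fun i => (Fin.cons (fun p : TotalSpace F 𝓕 => p.snd) fun i p => g i p.proj :
      Fin (n + 1) → ∀ p : TotalSpace F 𝓕, 𝓕 p.proj) i q) =
        Fin.cons q.snd fun i => g i q.proj := by
      ext i
      refine Fin.cases ?_ (fun j => ?_) i <;> simp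
    rw [h1, linearIndependent_finCons, hgq.span_eq] at hq
    exact hq.2
  · refine Fin.cases ?_ (fun j => ?_) i
    · exact continuousAt_id
    · exact (hg.self_of_nhds.continuousAt j).comp hproj
  · have h1 : (fun i => (Fin.cons (fun p : TotalSpace F 𝓕 => p.snd) fun i p => g i p.proj :
      Fin (n + 1) → ∀ p : TotalSpace F 𝓕, 𝓕 p.proj) i p) =
        Fin.cons p.snd fun i => g i p.proj := by
      ext i
      refine Fin.cases ?_ (fun j => ?_) i <;> simp
    rw [h1, linearIndependent_finCons, hg.self_of_nhds.span_eq]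
    exact ⟨hg.self_of_nhds.linearIndependent, hp⟩

variable [CompactSpace B] [T2Space B] [CompleteSpace F]

theorem exists_section_notMem_near (hF : ¬ FiniteDimensional 𝕜 F) (V : FDSubbundle 𝕜 F 𝓕) (x₀ : B) :
    ∃ K ∈ 𝓝 x₀, IsClosed K ∧ ∀ ξ : ∀ x, 𝓕 x, Continuous (fun x => (⟨x, ξ x⟩ : TotalSpace F 𝓕)) →
      ∀ O : Set (TotalSpace F 𝓕), IsOpen O → (∀ x, ⟨x, ξ x⟩ ∈ O) →
      ∃ τ : ∀ x, 𝓕 x, Continuous (fun x => (⟨x, τ x⟩ : TotalSpace F 𝓕)) ∧ (∀ x, ⟨x, τ x⟩ ∈ O) ∧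
        ∀ x ∈ K, τ x ∉ V.carrier x := by
  obtain ⟨n, g, hg⟩ := V.isFDSubbundle.exists_frame x₀
  let e := trivializationAt F 𝓕 x₀
  have he : x₀ ∈ e.baseSet := mem_baseSet_trivializationAt F 𝓕 x₀
  obtain ⟨ρ, hρ, hρ0, hρ1, hρs⟩ := exists_bump (hg.and (e.open_baseSet.mem_nhds he))
  have hKs : ∀ x, ρ x = 1 → IsFrameAt F V.carrier g x ∧ x ∈ e.baseSet := fun x hx =>
    hρs (subset_tsupport ρ (by simp [hx]))
  refine ⟨{x | ρ x = 1}, hρ1, isClosed_eq hρ continuous_const, fun ξ hξ O hO hξO => ?_⟩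
  have hK : IsCompact {x | ρ x = 1} := (isClosed_eq hρ continuous_const).isCompact
  have hτ : Continuous fun q : B × F =>
      (⟨q.1, ξ q.1 + (ρ q.1 : 𝕜) • e.symmL 𝕜 q.1 q.2⟩ : TotalSpace F 𝓕) := by
    refine continuous_iff_continuousAt.2 fun q => continuousAt_totalSpace_add (𝕜 := 𝕜)
      (b := fun q : B × F => q.1) (y := fun q => ξ q.1)
      (z := fun q => (ρ q.1 : 𝕜) • e.symmL 𝕜 q.1 q.2)
      (hξ.comp continuous_fst).continuousAt (Continuous.continuousAt ?_)
    refine continuous_totalSpace_smul_of_tsupport (ρ := fun x => (ρ x : 𝕜)) (U := e.baseSet)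
      (b := fun q : B × F => q.1) (y := fun q => e.symmL 𝕜 q.1 q.2)
      (RCLike.continuous_ofReal.comp hρ) ?_ continuous_fst fun q hq =>
        continuousAt_totalSpace_symmL e hq continuousAt_fst continuousAt_snd
    refine Set.Subset.trans (closure_mono ?_) fun x hx => (hρs hx).2
    exact fun x hx h => hx (by simp [h])
  obtain ⟨u, v, -, hv, hu, h0, huv⟩ := generalized_tube_lemma (isCompact_univ (X := B))
    (isCompact_singleton (x := (0 : F))) (hO.preimage hτ) (by
      rintro ⟨x, w⟩ ⟨-, rfl⟩
      simpa using hξO x)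
  have hφ : ContinuousOn (fun q : B × (Fin n → 𝕜) =>
      (∑ i, q.2 i • e.continuousLinearMapAt 𝕜 q.1 (g i q.1)) - e.continuousLinearMapAt 𝕜 q.1 (ξ q.1))
      ({x | ρ x = 1} ×ˢ Set.univ) := by
    rintro ⟨x, a⟩ ⟨hx, -⟩
    refine ContinuousAt.continuousWithinAt ?_
    have hx' := hKs x hx
    refine ContinuousAt.sub (tendsto_finsetSum _ fun i _ => ContinuousAt.smul
      (Continuous.continuousAt (by fun_prop)) ?_) ?_
    · exact ContinuousAt.comp (f := fun q : B × (Fin n → 𝕜) => q.1) (x := (x, a))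
        (g := fun x => e.continuousLinearMapAt 𝕜 x (g i x))
        ((continuousAt_totalSpace_iff_coord 𝕜 e hx'.2 (b := id)).1
          (hx'.1.continuousAt i)).2 continuousAt_fst
    · exact ContinuousAt.comp (f := fun q : B × (Fin n → 𝕜) => q.1) (x := (x, a))
        (g := fun x => e.continuousLinearMapAt 𝕜 x (ξ x))
        ((continuousAt_totalSpace_iff_coord 𝕜 e hx'.2 (b := id)).1
          hξ.continuousAt).2 continuousAt_fst
  obtain ⟨w, hwv, hwD⟩ := (dense_compl_image_prod_of_infiniteDimensional hF hK hφ).inter_open_nonempty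
    v hv ⟨0, h0 rfl⟩
  refine ⟨fun x => ξ x + (ρ x : 𝕜) • e.symmL 𝕜 x w, hτ.comp (Continuous.prodMk_left w),
    fun x => huv (Set.mk_mem_prod (hu trivial) hwv), fun x hx hV => hwD ?_⟩
  have hx' := hKs x hx
  rw [← hx'.1.span_eq] at hV
  obtain ⟨a, ha⟩ := (Submodule.mem_span_range_iff_exists_fun 𝕜).1 hV
  refine ⟨(x, a), ⟨hx, trivial⟩, ?_⟩
  have h1 := congrArg (e.continuousLinearMapAt 𝕜 x) ha
  simp only at h1
  rw [show ρ x = 1 from hx, map_add, map_sum] at h1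
  simp only [RCLike.ofReal_one, one_smul] at h1
  rw [e.continuousLinearMapAt_symmL hx'.2] at h1
  simp only [map_smul] at h1
  simp only
  rw [h1, add_sub_cancel_left]

/-- In a Banach bundle with infinite-dimensional fibres, every section can be perturbed so as to
avoid a given finite-dimensional subbundle. -/
theorem exists_section_notMem (hF : ¬ FiniteDimensional 𝕜 F) (V : FDSubbundle 𝕜 F 𝓕)
    {ξ : ∀ x, 𝓕 x} (hξ : Continuous (fun x => (⟨x, ξ x⟩ : TotalSpace F 𝓕)))
    {O : Set (TotalSpace F 𝓕)} (hO : IsOpen O) (hξO : ∀ x, ⟨x, ξ x⟩ ∈ O) :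
    ∃ τ : ∀ x, 𝓕 x, Continuous (fun x => (⟨x, τ x⟩ : TotalSpace F 𝓕)) ∧ (∀ x, ⟨x, τ x⟩ ∈ O) ∧
      ∀ x, τ x ∉ V.carrier x := by
  obtain ⟨K, hK, -, h⟩ : ∃ K, Set.univ ⊆ K ∧ IsClosed K ∧
      ∀ ξ : ∀ x, 𝓕 x, Continuous (fun x => (⟨x, ξ x⟩ : TotalSpace F 𝓕)) →
      ∀ O : Set (TotalSpace F 𝓕), IsOpen O → (∀ x, ⟨x, ξ x⟩ ∈ O) →
      ∃ τ : ∀ x, 𝓕 x, Continuous (fun x => (⟨x, τ x⟩ : TotalSpace F 𝓕)) ∧ (∀ x, ⟨x, τ x⟩ ∈ O) ∧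
        ∀ x ∈ K, τ x ∉ V.carrier x := by
    refine isCompact_univ.induction_on (p := fun s => ∃ K, s ⊆ K ∧ IsClosed K ∧
      ∀ ξ : ∀ x, 𝓕 x, Continuous (fun x => (⟨x, ξ x⟩ : TotalSpace F 𝓕)) →
      ∀ O : Set (TotalSpace F 𝓕), IsOpen O → (∀ x, ⟨x, ξ x⟩ ∈ O) →
      ∃ τ : ∀ x, 𝓕 x, Continuous (fun x => (⟨x, τ x⟩ : TotalSpace F 𝓕)) ∧ (∀ x, ⟨x, τ x⟩ ∈ O) ∧
        ∀ x ∈ K, τ x ∉ V.carrier x) ?_ ?_ ?_ ?_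
    · exact ⟨∅, le_rfl, isClosed_empty, fun ξ hξ O _ h => ⟨ξ, hξ, h, by simp⟩⟩
    · rintro s t hst ⟨K, h1, h2⟩
      exact ⟨K, hst.trans h1, h2⟩
    · rintro s t ⟨K, hs, hK, h⟩ ⟨K', hs', hK', h'⟩
      refine ⟨K ∪ K', Set.union_subset_union hs hs', hK.union hK', fun ξ hξ O hO hξO => ?_⟩
      obtain ⟨τ, hτ, hτO, hτK⟩ := h ξ hξ O hO hξO
      obtain ⟨τ', hτ', hτO', hτK'⟩ := h' τ hτ
        (O ∩ (TotalSpace.proj ⁻¹' Kᶜ ∪ {p | p.snd ∉ V.carrier p.proj}))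
        (hO.inter ((hK.isOpen_compl.preimage (FiberBundle.continuous_proj F 𝓕)).union
          V.isOpen_compl)) fun x => ⟨hτO x, or_iff_not_imp_left.2 fun hx => hτK x (not_not.1 hx)⟩
      refine ⟨τ', hτ', fun x => (hτO' x).1, ?_⟩
      rintro x (hx | hx)
      · exact (hτO' x).2.resolve_left fun h => h hx
      · exact hτK' x hx
    · intro x₀ _
      obtain ⟨K, hK, hKc, h⟩ := exists_section_notMem_near hF V x₀
      exact ⟨K, mem_nhdsWithin_of_mem_nhds hK, K, le_rfl, hKc, h⟩
  obtain ⟨τ, h1, h2, h3⟩ := h ξ hξ O hO hξO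
  exact ⟨τ, h1, h2, fun x => h3 x (hK trivial)⟩

end Avoidance

section FrameConstructions

variable {B : Type u} [TopologicalSpace B] {𝕜 : Type} [RCLike 𝕜]
  {F : Type*} [NormedAddCommGroup F] [NormedSpace 𝕜 F] {𝓕 : B → Type v}
  [∀ x, AddCommGroup (𝓕 x)] [∀ x, Module 𝕜 (𝓕 x)] [TopologicalSpace (TotalSpace F 𝓕)]
  [∀ x, TopologicalSpace (𝓕 x)] [FiberBundle F 𝓕] [VectorBundle 𝕜 F 𝓕]

theorem isFDSubbundle_bot : IsFDSubbundle F fun x => (⊥ : Submodule 𝕜 (𝓕 x)) :=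
  isFDSubbundle_of_exists_frame fun x₀ => ⟨0, Fin.elim0, Filter.Eventually.of_forall fun x =>
    ⟨fun i => i.elim0, linearIndependent_empty_type, by simp⟩⟩

theorem isFDSubbundle_top [FiniteDimensional 𝕜 F] :
    IsFDSubbundle F fun x => (⊤ : Submodule 𝕜 (𝓕 x)) := by
  refine isFDSubbundle_of_exists_frame fun x₀ => ?_
  let e := trivializationAt F 𝓕 x₀
  have he : x₀ ∈ e.baseSet := mem_baseSet_trivializationAt F 𝓕 x₀
  let β := Module.finBasis 𝕜 F
  refine ⟨_, fun i x => e.symmL 𝕜 x (β i), ?_⟩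
  filter_upwards [e.open_baseSet.mem_nhds he] with x hx
  have hfun : (fun i => e.symmL 𝕜 x (β i)) =
      (e.continuousLinearEquivAt 𝕜 x hx).symm.toLinearEquiv.toLinearMap ∘ β := by
    ext1 i
    simp [e.symmL_apply hx]
  refine ⟨fun i => continuousAt_totalSpace_symmL (b := id) e hx continuousAt_id
    continuousAt_const, ?_, ?_⟩
  · rw [hfun]
    exact β.linearIndependent.map' _ (LinearEquiv.ker _)
  · rw [hfun, Set.range_comp, Submodule.span_image, β.span_eq, Submodule.map_top]
    exact LinearEquiv.range _

theorem FDSubbundle.isFDSubbundle_sup_span (V : FDSubbundle 𝕜 F 𝓕) {τ : ∀ x, 𝓕 x}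
    (hτ : Continuous (fun x => (⟨x, τ x⟩ : TotalSpace F 𝓕))) (h : ∀ x, τ x ∉ V.carrier x) :
    IsFDSubbundle F fun x => V.carrier x ⊔ Submodule.span 𝕜 {τ x} := by
  refine isFDSubbundle_of_exists_frame fun x₀ => ?_
  obtain ⟨n, g, hg⟩ := V.isFDSubbundle.exists_frame x₀
  refine ⟨n + 1, Fin.cons τ g, ?_⟩
  filter_upwards [hg] with x hx
  have hfun : (fun i => (Fin.cons τ g : Fin (n + 1) → ∀ x, 𝓕 x) i x) =
      Fin.cons (τ x) fun i => g i x := by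
    ext i
    refine Fin.cases ?_ (fun j => ?_) i <;> simp
  refine ⟨fun i => ?_, ?_, ?_⟩
  · refine Fin.cases ?_ (fun j => ?_) i
    · exact hτ.continuousAt
    · exact hx.continuousAt j
  · rw [hfun, linearIndependent_finCons, hx.span_eq]
    exact ⟨hx.linearIndependent, h x⟩
  · rw [hfun, Fin.range_cons, Set.insert_eq, Submodule.span_union, hx.span_eq, sup_comm]

include 𝕜 in
/-- A vector in a fibre extends to a global section. -/
theorem exists_section_eq [CompactSpace B] [T2Space B] {x₀ : B} (y : 𝓕 x₀) :
    ∃ ξ : ∀ x, 𝓕 x, Continuous (fun x => (⟨x, ξ x⟩ : TotalSpace F 𝓕)) ∧ ξ x₀ = y := by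
  let e := trivializationAt F 𝓕 x₀
  have he : x₀ ∈ e.baseSet := mem_baseSet_trivializationAt F 𝓕 x₀
  obtain ⟨ρ, hρ, -, hρ1, hρs⟩ := exists_bump (e.open_baseSet.mem_nhds he)
  refine ⟨fun x => (ρ x : 𝕜) • e.symmL 𝕜 x (e.continuousLinearMapAt 𝕜 x₀ y), ?_, ?_⟩
  · refine continuous_totalSpace_smul_of_tsupport (b := id) (ρ := fun x => (ρ x : 𝕜))
      (RCLike.continuous_ofReal.comp hρ) (U := e.baseSet) ?_ continuous_id fun x hx =>
        continuousAt_totalSpace_symmL e hx continuousAt_id continuousAt_const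
    refine Set.Subset.trans (closure_mono ?_) hρs
    exact fun x hx h => hx (by simp [h])
  · simp only
    rw [e.symmL_continuousLinearMapAt he, hρ1.self_of_nhds, RCLike.ofReal_one, one_smul]

end FrameConstructions

section Transversal

variable {B : Type u} [TopologicalSpace B] {𝕜 : Type} [RCLike 𝕜]
  {E : Type*} [NormedAddCommGroup E] [NormedSpace 𝕜 E] {𝓔 : B → Type v}
  [∀ x, AddCommGroup (𝓔 x)] [∀ x, Module 𝕜 (𝓔 x)] [TopologicalSpace (TotalSpace E 𝓔)]
  [∀ x, TopologicalSpace (𝓔 x)] [FiberBundle E 𝓔] [VectorBundle 𝕜 E 𝓔]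
  {F : Type*} [NormedAddCommGroup F] [NormedSpace 𝕜 F] {𝓕 : B → Type v}
  [∀ x, AddCommGroup (𝓕 x)] [∀ x, Module 𝕜 (𝓕 x)] [TopologicalSpace (TotalSpace F 𝓕)]
  [∀ x, TopologicalSpace (𝓕 x)] [FiberBundle F 𝓕] [VectorBundle 𝕜 F 𝓕]
  [∀ x, IsTopologicalAddGroup (𝓕 x)] [∀ x, ContinuousSMul 𝕜 (𝓕 x)]
  [CompleteSpace E] [CompleteSpace F]

namespace BanachBundleHom

variable {L : BanachBundleHom 𝕜 E 𝓔 F 𝓕}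

theorem isOpen_range_sup_span_eq_top (hL : ∀ x, FiniteDimensional 𝕜 (L.toFun x).ker)
    (V : FDSubbundle 𝕜 F 𝓕) {k : ℕ} {g : Fin k → ∀ x, 𝓕 x}
    (hg : ∀ i, Continuous (fun x => (⟨x, g i x⟩ : TotalSpace F 𝓕))) :
    IsOpen {p : TotalSpace F 𝓕 | (L.toFun p.proj).range ⊔ (V.carrier p.proj ⊔
      (Submodule.span 𝕜 {p.snd} ⊔ Submodule.span 𝕜 (Set.range fun i => g i p.proj))) = ⊤} := by
  refine isOpen_iff_mem_nhds.2 fun p hp => ?_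
  obtain ⟨n, γ, hγ⟩ := V.isFDSubbundle.exists_frame p.proj
  have hproj := (FiberBundle.continuous_proj F 𝓕).continuousAt (x := p)
  let G : Fin n ⊕ (Unit ⊕ Fin k) → ∀ p : TotalSpace F 𝓕, 𝓕 p.proj :=
    Sum.elim (fun i p => γ i p.proj) (Sum.elim (fun _ p => p.snd) fun i p => g i p.proj)
  have hG : ∀ q : TotalSpace F 𝓕, IsFrameAt F V.carrier γ q.proj →
      Submodule.span 𝕜 (Set.range fun i => G i q) = V.carrier q.proj ⊔
      (Submodule.span 𝕜 {q.snd} ⊔ Submodule.span 𝕜 (Set.range fun i => g i q.proj)) := by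
    intro q hq
    have h1 : (fun i => G i q) = Sum.elim (fun i => γ i q.proj)
        (Sum.elim (fun _ => q.snd) fun i => g i q.proj) := by
      ext (i | i | i) <;> rfl
    rw [h1, Set.Sum.elim_range, Set.Sum.elim_range, Submodule.span_union, Submodule.span_union,
      hq.span_eq, Set.range_const]
  have h := L.eventually_range_sup_span_eq_top (b := fun p : TotalSpace F 𝓕 => p.proj) (t₀ := p)
    (g := G) hproj (by
      rintro (i | i | i)
      · exact (hγ.self_of_nhds.continuousAt i).comp hproj
      · exact continuousAt_id
      · exact (hg i).continuousAt.comp hproj) (hL _) (by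
      rw [hG p hγ.self_of_nhds]
      exact hp)
  filter_upwards [h, hproj.eventually hγ] with q hq hγq
  rw [hG q hγq] at hq
  exact hq

variable [CompactSpace B] [T2Space B]

theorem exists_isTransversal_of_sections (hF : ¬ FiniteDimensional 𝕜 F)
    (hL : ∀ x, FiniteDimensional 𝕜 (L.toFun x).ker) (k : ℕ) :
    ∀ (V : FDSubbundle 𝕜 F 𝓕) (g : Fin k → ∀ x, 𝓕 x)
      (_ : ∀ i, Continuous (fun x => (⟨x, g i x⟩ : TotalSpace F 𝓕)))
      (_ : ∀ x, (L.toFun x).range ⊔ (V.carrier x ⊔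
        Submodule.span 𝕜 (Set.range fun i => g i x)) = ⊤),
      ∃ V : FDSubbundle 𝕜 F 𝓕, L.IsTransversal V := by
  induction k with
  | zero =>
    intro V g _ h
    exact ⟨V, fun x => by simpa using h x⟩
  | succ k ih =>
    intro V g hg h
    have hr : ∀ x, (Set.range fun i => g i x) = insert (g 0 x) (Set.range fun i : Fin k => g i.succ x) :=
      fun x => by rw [← Fin.range_cons]; congr 1; ext i; refine Fin.cases ?_ (fun j => ?_) i <;> simp
    obtain ⟨τ, hτ, hτO, hτV⟩ := exists_section_notMem hF V (hg 0)
      (isOpen_range_sup_span_eq_top hL V (g := fun i => g i.succ) fun i => hg i.succ) fun x => by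
        have := h x
        rw [hr, Set.insert_eq, Submodule.span_union] at this
        exact this
    refine ih ⟨_, V.isFDSubbundle_sup_span hτ hτV⟩ (fun i => g i.succ) (fun i => hg i.succ)
      fun x => ?_
    have := hτO x
    simp only [Set.mem_ofPred_eq, ← sup_assoc] at this ⊢
    exact this

theorem exists_transversal_sections (hL : L.IsFredholm) :
    ∃ (k : ℕ) (g : Fin k → ∀ x, 𝓕 x),
      (∀ i, Continuous (fun x => (⟨x, g i x⟩ : TotalSpace F 𝓕))) ∧
      ∀ x ∈ Set.univ, (L.toFun x).range ⊔ Submodule.span 𝕜 (Set.range fun i => g i x) = ⊤ := by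
  refine isCompact_univ.induction_on (p := fun s => ∃ (k : ℕ) (g : Fin k → ∀ x, 𝓕 x),
      (∀ i, Continuous (fun x => (⟨x, g i x⟩ : TotalSpace F 𝓕))) ∧
      ∀ x ∈ s, (L.toFun x).range ⊔ Submodule.span 𝕜 (Set.range fun i => g i x) = ⊤) ?_ ?_ ?_ ?_
  · exact ⟨0, Fin.elim0, fun i => i.elim0, by simp⟩
  · rintro s t hst ⟨k, g, hg, h⟩
    exact ⟨k, g, hg, fun x hx => h x (hst hx)⟩
  · rintro s t ⟨k, g, hg, h⟩ ⟨k', g', hg', h'⟩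
    have hr : ∀ x, (Set.range fun i => (Fin.append g g' i) x) =
        (Set.range fun i => g i x) ∪ (Set.range fun i => g' i x) := by
      intro x
      ext y
      constructor
      · rintro ⟨i, rfl⟩
        refine Fin.addCases (fun j => Or.inl ⟨j, ?_⟩) (fun j => Or.inr ⟨j, ?_⟩) i <;> simp
      · rintro (⟨j, rfl⟩ | ⟨j, rfl⟩)
        · exact ⟨Fin.castAdd k' j, by simp⟩
        · exact ⟨Fin.natAdd k j, by simp⟩
    refine ⟨k + k', Fin.append g g', fun i => ?_, ?_⟩
    · refine Fin.addCases (fun j => ?_) (fun j => ?_) i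
      · simpa using hg j
      · simpa using hg' j
    · rintro x (hx | hx) <;> rw [hr, Submodule.span_union, eq_top_iff]
      · rw [← h x hx, ← sup_assoc]
        exact le_sup_left
      · rw [← h' x hx]
        exact sup_le_sup_left le_sup_right _
  · intro x₀ _
    obtain ⟨κ, hκ⟩ := hL
    have hk := (hκ x₀).1.finite_ker
    have hc : Module.Finite 𝕜 (𝓕 x₀ ⧸ (L.toFun x₀).range) := (hκ x₀).1.finite_coker
    obtain ⟨k, w, hw⟩ := Module.Finite.exists_fin (R := 𝕜) (M := 𝓕 x₀ ⧸ (L.toFun x₀).range)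
    choose y hy using fun i => Submodule.mkQ_surjective _ (w i)
    choose g hg hgy using fun i => exists_section_eq (𝕜 := 𝕜) (F := F) (y i)
    have h0 : (L.toFun x₀).range ⊔ Submodule.span 𝕜 (Set.range fun i => g i x₀) = ⊤ := by
      rw [← Submodule.map_mkQ_eq_top, ← Submodule.span_image, ← Set.range_comp, ← hw]
      congr 2
      ext1 i
      simp [hgy, ← hy]
    exact ⟨_, mem_nhdsWithin_of_mem_nhds (L.eventually_range_sup_span_eq_top (b := id)
      continuousAt_id (fun i => (hg i).continuousAt) hk h0), k, g, hg, fun x hx => hx⟩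

/-- A Fredholm morphism over a compact Hausdorff space admits a transversal finite-dimensional
subbundle. -/
theorem exists_isTransversal (hL : L.IsFredholm) : ∃ V : FDSubbundle 𝕜 F 𝓕, L.IsTransversal V := by
  by_cases hF : FiniteDimensional 𝕜 F
  · exact ⟨⟨_, isFDSubbundle_top⟩, fun x => sup_top_eq _⟩
  · obtain ⟨k, g, hg, h⟩ := exists_transversal_sections hL
    obtain ⟨κ, hκ⟩ := hL
    exact exists_isTransversal_of_sections hF (fun x => (hκ x).1.finite_ker) k
      ⟨_, isFDSubbundle_bot⟩ g hg fun x => by simpa using h x trivial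

end BanachBundleHom

end Transversal

section ToBundle

variable {B : Type u} [TopologicalSpace B] {𝕜 : Type} [RCLike 𝕜]
  {F : Type*} [NormedAddCommGroup F] [NormedSpace 𝕜 F] {𝓕 : B → Type v}
  [∀ x, AddCommGroup (𝓕 x)] [∀ x, Module 𝕜 (𝓕 x)] [TopologicalSpace (TotalSpace F 𝓕)]

omit [NormedAddCommGroup F] [NormedSpace 𝕜 F] in
theorem FDSubbundle.continuous_toBundle (V : FDSubbundle 𝕜 F 𝓕) {T : Type*} [TopologicalSpace T]
    {b : T → B} {s : ∀ t, V.carrier (b t)}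
    (h : Continuous fun t => (⟨b t, (s t : 𝓕 (b t))⟩ : TotalSpace F 𝓕)) :
    Continuous fun t => (⟨b t, s t⟩ : TotalSpace Unit V.toBundle.fiber) :=
  continuous_induced_rng.2 h

omit [NormedAddCommGroup F] [NormedSpace 𝕜 F] in
theorem FDSubbundle.continuous_inclusion (V : FDSubbundle 𝕜 F 𝓕) :
    Continuous fun p : TotalSpace Unit V.toBundle.fiber =>
      (⟨p.proj, V.carrier p.proj |>.subtype p.snd⟩ : TotalSpace F 𝓕) :=
  continuous_induced_dom

end ToBundle

section Independence

variable {B : Type u} [TopologicalSpace B] {𝕜 : Type} [RCLike 𝕜]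
  {E : Type*} [NormedAddCommGroup E] [NormedSpace 𝕜 E] {𝓔 : B → Type v}
  [∀ x, AddCommGroup (𝓔 x)] [∀ x, Module 𝕜 (𝓔 x)] [TopologicalSpace (TotalSpace E 𝓔)]
  [∀ x, TopologicalSpace (𝓔 x)] [FiberBundle E 𝓔] [VectorBundle 𝕜 E 𝓔]
  {F : Type*} [NormedAddCommGroup F] [NormedSpace 𝕜 F] {𝓕 : B → Type v}
  [∀ x, AddCommGroup (𝓕 x)] [∀ x, Module 𝕜 (𝓕 x)] [TopologicalSpace (TotalSpace F 𝓕)]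
  [∀ x, TopologicalSpace (𝓕 x)] [FiberBundle F 𝓕] [VectorBundle 𝕜 F 𝓕]
  [∀ x, IsTopologicalAddGroup (𝓕 x)] [∀ x, ContinuousSMul 𝕜 (𝓕 x)]

namespace BanachBundleHom

variable {L : BanachBundleHom 𝕜 E 𝓔 F 𝓕}

/-- The map `E(L, V) ⊕ V' → E(L, V') ⊕ V` given, in terms of right inverses `r`, `r'` of `L` modulo
`V`, `V'`, by `(u, v) ↦ (m - r' (L m - v), L m - v)` with `m = u + r v`. -/
def exchange {V V' : FDSubbundle 𝕜 F 𝓕} {r r' : ∀ x, 𝓕 x →ₗ[𝕜] 𝓔 x}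
    (hr : ∀ x y, L.toFun x (r x y) - y ∈ V.carrier x)
    (hr' : ∀ x y, L.toFun x (r' x y) - y ∈ V'.carrier x) (x : B)
    (p : L.preimage V x × V'.carrier x) : L.preimage V' x × V.carrier x :=
  (⟨p.1 + r x p.2 - r' x (L.toFun x (p.1 + r x p.2) - p.2), by
    change L.toFun x _ ∈ V'.carrier x
    convert (V'.carrier x).sub_mem p.2.2
      (hr' x (L.toFun x (p.1 + r x p.2) - p.2)) using 1
    rw [map_sub]
    abel⟩,
  ⟨L.toFun x (p.1 + r x p.2) - p.2, by
    have h : L.toFun x p.1 ∈ V.carrier x := p.1.2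
    convert (V.carrier x).add_mem h (hr x p.2) using 1
    rw [map_add]
    abel⟩)

theorem exchange_exchange {V V' : FDSubbundle 𝕜 F 𝓕} {r r' : ∀ x, 𝓕 x →ₗ[𝕜] 𝓔 x}
    (hr : ∀ x y, L.toFun x (r x y) - y ∈ V.carrier x)
    (hr' : ∀ x y, L.toFun x (r' x y) - y ∈ V'.carrier x) (x : B)
    (p : L.preimage V x × V'.carrier x) :
    exchange hr' hr x (exchange hr hr' x p) = p := by
  refine Prod.ext (Subtype.ext ?_) (Subtype.ext ?_) <;> simp [exchange]

/-- `exchange` as a linear equivalence. -/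
def exchangeEquiv {V V' : FDSubbundle 𝕜 F 𝓕} {r r' : ∀ x, 𝓕 x →ₗ[𝕜] 𝓔 x}
    (hr : ∀ x y, L.toFun x (r x y) - y ∈ V.carrier x)
    (hr' : ∀ x y, L.toFun x (r' x y) - y ∈ V'.carrier x) (x : B) :
    (L.preimage V x × V'.carrier x) ≃ₗ[𝕜] L.preimage V' x × V.carrier x where
  toFun := exchange hr hr' x
  map_add' p q := by
    refine Prod.ext (Subtype.ext ?_) (Subtype.ext ?_) <;> simp [exchange] <;> abel
  map_smul' c p := by
    refine Prod.ext (Subtype.ext ?_) (Subtype.ext ?_) <;> simp [exchange, smul_sub, smul_add]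
  invFun := exchange hr' hr x
  left_inv := exchange_exchange hr hr' x
  right_inv := exchange_exchange hr' hr x

theorem continuous_exchange {V V' : FDSubbundle 𝕜 F 𝓕} {r r' : ∀ x, 𝓕 x →ₗ[𝕜] 𝓔 x}
    (hr : ∀ x y, L.toFun x (r x y) - y ∈ V.carrier x)
    (hr' : ∀ x y, L.toFun x (r' x y) - y ∈ V'.carrier x)
    (hrc : Continuous fun p : TotalSpace F 𝓕 => (⟨p.proj, r p.proj p.snd⟩ : TotalSpace E 𝓔))
    (hrc' : Continuous fun p : TotalSpace F 𝓕 => (⟨p.proj, r' p.proj p.snd⟩ : TotalSpace E 𝓔))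
    (h : IsFDSubbundle E (L.preimage V)) (h' : IsFDSubbundle E (L.preimage V')) :
    Continuous fun p : TotalSpace Unit
        ((FDSubbundle.toBundle ⟨L.preimage V, h⟩).sum V'.toBundle).fiber =>
      (⟨p.proj, exchange hr hr' p.proj p.snd⟩ : TotalSpace Unit
        ((FDSubbundle.toBundle ⟨L.preimage V', h'⟩).sum V.toBundle).fiber) := by
  let A := FDSubbundle.toBundle ⟨L.preimage V, h⟩
  have hu : Continuous fun p : TotalSpace Unit (A.sum V'.toBundle).fiber =>
      (⟨p.proj, (L.preimage V p.proj).subtype p.snd.1⟩ : TotalSpace E 𝓔) :=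
    (FDSubbundle.continuous_inclusion ⟨L.preimage V, h⟩).comp
      (FDBundle.continuous_prod_fst A V'.toBundle)
  have hv : Continuous fun p : TotalSpace Unit (A.sum V'.toBundle).fiber =>
      (⟨p.proj, (V'.carrier p.proj).subtype p.snd.2⟩ : TotalSpace F 𝓕) :=
    V'.continuous_inclusion.comp (FDBundle.continuous_prod_snd A V'.toBundle)
  have hm : Continuous fun p : TotalSpace Unit (A.sum V'.toBundle).fiber =>
      (⟨p.proj, (L.preimage V p.proj).subtype p.snd.1 +
        r p.proj ((V'.carrier p.proj).subtype p.snd.2)⟩ : TotalSpace E 𝓔) :=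
    continuous_iff_continuousAt.2 fun p => continuousAt_totalSpace_add (𝕜 := 𝕜)
      hu.continuousAt (hrc.comp hv).continuousAt
  have hz : Continuous fun p : TotalSpace Unit (A.sum V'.toBundle).fiber =>
      (⟨p.proj, L.toFun p.proj ((L.preimage V p.proj).subtype p.snd.1 +
        r p.proj ((V'.carrier p.proj).subtype p.snd.2)) - (V'.carrier p.proj).subtype p.snd.2⟩ :
          TotalSpace F 𝓕) :=
    continuous_iff_continuousAt.2 fun p => continuousAt_totalSpace_sub (𝕜 := 𝕜)
      (L.continuous_apply hm).continuousAt hv.continuousAt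
  refine FDBundle.continuous_prod_mk (FDSubbundle.toBundle ⟨L.preimage V', h'⟩) V.toBundle
    (b := fun p : TotalSpace Unit (A.sum V'.toBundle).fiber => p.proj)
    (f := fun p => (exchange hr hr' p.proj p.snd).1)
    (g := fun p => (exchange hr hr' p.proj p.snd).2) ?_ ?_
  · refine FDSubbundle.continuous_toBundle ⟨L.preimage V', h'⟩ ?_
    exact continuous_iff_continuousAt.2 fun p => continuousAt_totalSpace_sub (𝕜 := 𝕜)
      hm.continuousAt (hrc'.comp hz).continuousAt
  · exact V.continuous_toBundle hz

theorem isIndexBundle_ind (h : ∃ κ, L.IsIndexBundle κ) : L.IsIndexBundle L.ind := by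
  rw [ind, dif_pos h]
  exact h.choose_spec

variable [CompleteSpace E] [CompleteSpace F] [CompactSpace B] [T2Space B]

/-- The class `[E(L, V)] - [V]` does not depend on `V`. -/
theorem ofBundle_preimage_sub_eq (hL : ∀ x, FiniteDimensional 𝕜 (L.toFun x).ker)
    {V V' : FDSubbundle 𝕜 F 𝓕} (hV : L.IsTransversal V) (hV' : L.IsTransversal V')
    (h : IsFDSubbundle E (L.preimage V)) (h' : IsFDSubbundle E (L.preimage V')) :
    KGroup.ofBundle (FDSubbundle.toBundle ⟨L.preimage V, h⟩) - KGroup.ofBundle V.toBundle =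
      KGroup.ofBundle (FDSubbundle.toBundle ⟨L.preimage V', h'⟩) -
        KGroup.ofBundle V'.toBundle := by
  obtain ⟨r, hr, hrc⟩ := exists_rightInverse_mod hL V hV
  obtain ⟨r', hr', hrc'⟩ := exists_rightInverse_mod hL V' hV'
  have hiso : FDBundle.IsIso ((FDSubbundle.toBundle ⟨L.preimage V, h⟩).sum V'.toBundle)
      ((FDSubbundle.toBundle ⟨L.preimage V', h'⟩).sum V.toBundle) :=
    ⟨exchangeEquiv hr hr', continuous_exchange hr hr' hrc hrc' h h',
      continuous_exchange hr' hr hrc' hrc h' h⟩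
  rw [sub_eq_sub_iff_add_eq_add]
  have hq : VectClass.mk (FDSubbundle.toBundle ⟨L.preimage V, h⟩) + VectClass.mk V'.toBundle =
      VectClass.mk (FDSubbundle.toBundle ⟨L.preimage V', h'⟩) + VectClass.mk V.toBundle :=
    Quotient.sound hiso
  have := congrArg Algebra.GrothendieckAddGroup.of hq
  rwa [map_add, map_add] at this

/-- The index bundle of a Fredholm morphism over a compact Hausdorff space is well defined. -/
theorem exists_isIndexBundle (hL : L.IsFredholm) : ∃ κ, L.IsIndexBundle κ := by
  obtain ⟨V, hV⟩ := exists_isTransversal hL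
  obtain ⟨k, hk⟩ := hL
  have hker : ∀ x, FiniteDimensional 𝕜 (L.toFun x).ker := fun x => (hk x).1.finite_ker
  exact ⟨_, ⟨V, hV⟩, fun V' hV' => ⟨isFDSubbundle_preimage hker V' hV',
    ofBundle_preimage_sub_eq hker hV hV' (isFDSubbundle_preimage hker V hV) _⟩⟩

end BanachBundleHom

end Independence

section Embedding

variable {B : Type u} [TopologicalSpace B] {𝕜 : Type} [RCLike 𝕜]
  {F : Type*} [NormedAddCommGroup F] [NormedSpace 𝕜 F] {𝓕 : B → Type v}
  [∀ x, AddCommGroup (𝓕 x)] [∀ x, Module 𝕜 (𝓕 x)] [TopologicalSpace (TotalSpace F 𝓕)]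
  [∀ x, TopologicalSpace (𝓕 x)] [FiberBundle F 𝓕] [VectorBundle 𝕜 F 𝓕]

/-- `V` is, up to the scalar function `w`, a direct summand of a trivial bundle: there are maps
`s : V → B × 𝕜ⁿ` and `q : B × 𝕜ⁿ → V` with `q ∘ s = w`. -/
structure FDSubbundle.WeightedSummand (V : FDSubbundle 𝕜 F 𝓕) (w : B → ℝ) where
  ι : Type
  [fintype : Fintype ι]
  s : ∀ x, V.carrier x →ₗ[𝕜] (ι → 𝕜)
  q : ∀ x, (ι → 𝕜) →ₗ[𝕜] V.carrier x
  q_s : ∀ x y, q x (s x y) = (w x : 𝕜) • y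
  continuous_s : Continuous fun p : TotalSpace Unit V.toBundle.fiber => s p.proj p.snd
  continuous_q : Continuous fun p : B × (ι → 𝕜) => (⟨p.1, q p.1 p.2⟩ : TotalSpace F 𝓕)

attribute [instance] FDSubbundle.WeightedSummand.fintype

namespace FDSubbundle

variable {V : FDSubbundle 𝕜 F 𝓕}

/-- The weights add up under direct sums of the trivial bundles. -/
def WeightedSummand.add {w w' : B → ℝ} (S₁ : V.WeightedSummand w) (S₂ : V.WeightedSummand w') :
    V.WeightedSummand (w + w') where
  ι := S₁.ι ⊕ S₂.ι
  s x := (LinearEquiv.sumArrowLequivProdArrow S₁.ι S₂.ι 𝕜 𝕜).symm.toLinearMap ∘ₗ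
    (S₁.s x).prod (S₂.s x)
  q x := ((S₁.q x).coprod (S₂.q x)) ∘ₗ
    (LinearEquiv.sumArrowLequivProdArrow S₁.ι S₂.ι 𝕜 𝕜).toLinearMap
  q_s x y := by simp [S₁.q_s, S₂.q_s, add_smul]
  continuous_s := by
    refine continuous_pi fun i => ?_
    rcases i with i | i
    · exact (continuous_apply i).comp S₁.continuous_s
    · exact (continuous_apply i).comp S₂.continuous_s
  continuous_q := continuous_iff_continuousAt.2 fun p => by
    have h1 : Continuous fun p : B × (S₁.ι ⊕ S₂.ι → 𝕜) => (p.1, fun i => p.2 (Sum.inl i)) := by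
      fun_prop
    have h2 : Continuous fun p : B × (S₁.ι ⊕ S₂.ι → 𝕜) => (p.1, fun i => p.2 (Sum.inr i)) := by
      fun_prop
    exact continuousAt_totalSpace_add (𝕜 := 𝕜) (S₁.continuous_q.comp h1).continuousAt
      (S₂.continuous_q.comp h2).continuousAt

/-- Dividing by a nowhere vanishing weight. -/
noncomputable def WeightedSummand.normalize {w : B → ℝ} (S : V.WeightedSummand w)
    (hw : Continuous w) (h0 : ∀ x, w x ≠ 0) : V.WeightedSummand 1 where
  ι := S.ι
  s := S.s
  q x := (w x : 𝕜)⁻¹ • S.q x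
  q_s x y := by
    have : (w x : 𝕜) ≠ 0 := RCLike.ofReal_ne_zero.2 (h0 x)
    simp [S.q_s, smul_smul, this]
  continuous_s := S.continuous_s
  continuous_q := continuous_iff_continuousAt.2 fun p => by
    refine continuousAt_totalSpace_smul (c := fun p : B × (S.ι → 𝕜) => (w p.1 : 𝕜)⁻¹)
      (b := fun p : B × (S.ι → 𝕜) => p.1) (y := fun p => (S.q p.1 p.2 : 𝓕 p.1)) ?_
      S.continuous_q.continuousAt
    refine ContinuousAt.inv₀ ?_ (RCLike.ofReal_ne_zero.2 (h0 _))
    exact (RCLike.continuous_ofReal.comp (hw.comp continuous_fst)).continuousAt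

variable [CompactSpace B] [T2Space B]

theorem exists_local_weightedSummand (V : FDSubbundle 𝕜 F 𝓕) (x₀ : B) :
    ∃ w : B → ℝ, Continuous w ∧ (∀ x, 0 ≤ w x) ∧ (∀ᶠ x in 𝓝 x₀, 0 < w x) ∧
      Nonempty (V.WeightedSummand w) := by
  let _ := subfamilyTopology F V.carrier
  classical
  obtain ⟨U, hU, hxU, n, Φ, hΦ, hΦ'⟩ := V.isFDSubbundle.2 x₀
  obtain ⟨ρ, hρ, hρ0, hρ1, hρs⟩ := exists_bump (hU.mem_nhds hxU)
  let Ψ : ∀ x, V.carrier x →ₗ[𝕜] (Fin n → 𝕜) := fun x => if h : x ∈ U then Φ ⟨x, h⟩ else 0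
  let Ψ' : ∀ x, (Fin n → 𝕜) →ₗ[𝕜] V.carrier x := fun x =>
    if h : x ∈ U then (Φ ⟨x, h⟩).symm else 0
  have hΨ : ∀ x (h : x ∈ U), Ψ x = Φ ⟨x, h⟩ := fun x h => dif_pos h
  have hΨ' : ∀ x (h : x ∈ U), Ψ' x = (Φ ⟨x, h⟩).symm := fun x h => dif_pos h
  have hρ𝕜 : Continuous fun x => (ρ x : 𝕜) := RCLike.continuous_ofReal.comp hρ
  have hproj : Continuous (TotalSpace.proj : TotalSpace Unit (fun x => V.carrier x) → B) :=
    V.isFDSubbundle.1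
  have hΨc : ContinuousOn (fun p : TotalSpace Unit (fun x => V.carrier x) => Ψ p.proj p.snd)
      (TotalSpace.proj ⁻¹' U) := by
    rw [continuousOn_iff_continuous_domRestrict]
    exact hΦ.congr fun p => by simp [hΨ p.1.proj p.2]
  have hΨc' : ContinuousOn (fun p : B × (Fin n → 𝕜) => (⟨p.1, Ψ' p.1 p.2⟩ : TotalSpace F 𝓕))
      (Prod.fst ⁻¹' U) := by
    rw [continuousOn_iff_continuous_domRestrict]
    have h1 : Continuous fun p : (Prod.fst ⁻¹' U : Set (B × (Fin n → 𝕜))) =>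
        ((⟨p.1.1, p.2⟩ : U), p.1.2) := by fun_prop
    refine ((continuous_induced_dom.comp hΦ').comp h1).congr fun p => ?_
    simp [hΨ' p.1.1 p.2]
  refine ⟨fun x => ρ x * ρ x, hρ.mul hρ, fun x => mul_nonneg (hρ0 x) (hρ0 x), ?_, ⟨?_⟩⟩
  · filter_upwards [hρ1] with x hx
    simp [hx]
  · refine { ι := Fin n, s := fun x => (ρ x : 𝕜) • Ψ x, q := fun x => (ρ x : 𝕜) • Ψ' x, q_s := ?_,
             continuous_s := ?_, continuous_q := ?_ }
    · intro x y
      by_cases hx : x ∈ U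
      · rw [hΨ x hx, hΨ' x hx]
        simp only [LinearMap.smul_apply, map_smul, LinearEquiv.coe_coe,
          LinearEquiv.symm_apply_apply, smul_smul, RCLike.ofReal_mul]
      · simp [image_eq_zero_of_notMem_tsupport fun h => hx (hρs h)]
    · refine continuous_iff_continuousAt.2 fun p => ?_
      by_cases hp : p.proj ∈ tsupport ρ
      · exact (hρ𝕜.comp hproj).continuousAt.smul
          (hΨc.continuousAt ((hU.preimage hproj).mem_nhds (hρs hp)))
      · refine (continuousAt_const (y := (0 : Fin n → 𝕜))).congr ?_
        filter_upwards [((isClosed_tsupport ρ).isOpen_compl.preimage hproj).mem_nhds hp] with z hz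
        change (0 : Fin n → 𝕜) = (ρ z.proj : 𝕜) • Ψ z.proj z.snd
        rw [image_eq_zero_of_notMem_tsupport hz, RCLike.ofReal_zero, zero_smul]
    · refine continuous_totalSpace_smul_of_tsupport (ρ := fun x => (ρ x : 𝕜)) hρ𝕜 (U := U)
        (b := fun p : B × (Fin n → 𝕜) => p.1) (y := fun p => (Ψ' p.1 p.2 : 𝓕 p.1)) ?_ continuous_fst
        fun p hp => hΨc'.continuousAt ((hU.preimage continuous_fst).mem_nhds hp)
      refine Set.Subset.trans (closure_mono ?_) hρs
      exact fun x hx h => hx (by simp [h])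

/-- Over a compact Hausdorff space, a finite-dimensional subbundle is a direct summand of a trivial
bundle. -/
theorem nonempty_weightedSummand_one (V : FDSubbundle 𝕜 F 𝓕) :
    Nonempty (V.WeightedSummand 1) := by
  obtain ⟨w, hw, -, hw0, ⟨S⟩⟩ : ∃ w : B → ℝ, Continuous w ∧ (∀ x, 0 ≤ w x) ∧
      (∀ x ∈ Set.univ, 0 < w x) ∧ Nonempty (V.WeightedSummand w) := by
    refine isCompact_univ.induction_on (p := fun s => ∃ w : B → ℝ, Continuous w ∧ (∀ x, 0 ≤ w x) ∧
      (∀ x ∈ s, 0 < w x) ∧ Nonempty (V.WeightedSummand w)) ?_ ?_ ?_ ?_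
    · refine ⟨fun _ => 0, continuous_const, fun _ => le_rfl, by simp, ⟨⟨Fin 0, fun _ => 0, fun _ => 0,
        by simp, continuous_const, ?_⟩⟩⟩
      exact continuous_iff_continuousAt.2 fun p =>
        continuousAt_totalSpace_zero (𝕜 := 𝕜) continuousAt_fst
    · rintro s t hst ⟨w, h1, h2, h3, h4⟩
      exact ⟨w, h1, h2, fun x hx => h3 x (hst hx), h4⟩
    · rintro s t ⟨w, h1, h2, h3, ⟨S⟩⟩ ⟨w', h1', h2', h3', ⟨S'⟩⟩
      refine ⟨w + w', h1.add h1', fun x => add_nonneg (h2 x) (h2' x), ?_, ⟨S.add S'⟩⟩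
      rintro x (hx | hx)
      · exact add_pos_of_pos_of_nonneg (h3 x hx) (h2' x)
      · exact add_pos_of_nonneg_of_pos (h2 x) (h3' x hx)
    · intro x₀ _
      obtain ⟨w, h1, h2, h3, h4⟩ := V.exists_local_weightedSummand x₀
      exact ⟨_, mem_nhdsWithin_of_mem_nhds h3, w, h1, h2, fun x hx => hx, h4⟩
  exact ⟨S.normalize hw fun x => (hw0 x trivial).ne'⟩

end FDSubbundle

end Embedding

section Transport

variable {B : Type u} [TopologicalSpace B] {𝕜 : Type} [RCLike 𝕜]
  {F : Type*} [NormedAddCommGroup F] [NormedSpace 𝕜 F] {𝓕 : B → Type v}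
  [∀ x, AddCommGroup (𝓕 x)] [∀ x, Module 𝕜 (𝓕 x)] [TopologicalSpace (TotalSpace F 𝓕)]

namespace FDSubbundle.WeightedSummand

variable {V : FDSubbundle 𝕜 F 𝓕} (S : V.WeightedSummand 1)

omit [NormedAddCommGroup F] [NormedSpace 𝕜 F] in
theorem q_s_one (x : B) (y : V.carrier x) : S.q x (S.s x y) = y := by simp [S.q_s]

/-- The idempotent matrix onto the fibre of `V`. -/
noncomputable def proj (x : B) : (S.ι → 𝕜) →L[𝕜] (S.ι → 𝕜) :=
  (S.s x ∘ₗ S.q x).toContinuousLinearMap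

omit [NormedAddCommGroup F] [NormedSpace 𝕜 F] in
theorem continuous_proj : Continuous S.proj :=
  continuous_clm_apply.2 fun a => S.continuous_s.comp (V.continuous_toBundle
    (b := id) (S.continuous_q.comp (Continuous.prodMk_left a)))

omit [NormedAddCommGroup F] [NormedSpace 𝕜 F] in
theorem inverse_apply_transport {x y : B} (h : ‖S.proj x - S.proj y‖ < 1) (v : V.carrier x) :
    S.q x (Ring.inverse (1 - (S.proj x - S.proj y)) (S.s y (S.q y (S.s x v)))) = v := by
  have h1 : S.s y (S.q y (S.s x v)) = (1 - (S.proj x - S.proj y)) (S.s x v) := by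
    simp [proj, q_s_one]
  rw [h1]
  have h2 := DFunLike.congr_fun (Ring.inverse_mul_cancel _ (isUnit_one_sub_of_norm_lt_one h))
    (S.s x v)
  exact (congrArg (S.q x) h2).trans (S.q_s_one x v)

omit [NormedAddCommGroup F] [NormedSpace 𝕜 F] in
theorem injective_q_comp_s {x y : B} (h : ‖S.proj x - S.proj y‖ < 1) :
    Function.Injective (S.q y ∘ₗ S.s x) :=
  Function.LeftInverse.injective
    (g := fun w => S.q x (Ring.inverse (1 - (S.proj x - S.proj y)) (S.s y w)))
    (S.inverse_apply_transport h)

include S in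
omit [NormedAddCommGroup F] [NormedSpace 𝕜 F] in
theorem finiteDimensional_carrier (x : B) : FiniteDimensional 𝕜 (V.carrier x) :=
  Module.Finite.of_injective (S.s x) (Function.LeftInverse.injective (S.q_s_one x))

/-- The isomorphism between two fibres whose idempotents are close. -/
noncomputable def transport {x y : B} (h : ‖S.proj x - S.proj y‖ < 1) :
    V.carrier x ≃ₗ[𝕜] V.carrier y :=
  have := S.finiteDimensional_carrier x
  have := S.finiteDimensional_carrier y
  (S.q y ∘ₗ S.s x).linearEquivOfInjective (S.injective_q_comp_s h) (le_antisymm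
    (LinearMap.finrank_le_finrank_of_injective (S.injective_q_comp_s h))
    (LinearMap.finrank_le_finrank_of_injective
      (S.injective_q_comp_s (norm_sub_rev (S.proj x) _ ▸ h))))

omit [NormedAddCommGroup F] [NormedSpace 𝕜 F] in
theorem transport_apply {x y : B} (h : ‖S.proj x - S.proj y‖ < 1) (v : V.carrier x) :
    S.transport h v = S.q y (S.s x v) := rfl

omit [NormedAddCommGroup F] [NormedSpace 𝕜 F] in
theorem transport_symm_apply {x y : B} (h : ‖S.proj x - S.proj y‖ < 1) (v : V.carrier y) :
    (S.transport h).symm v =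
      S.q x (Ring.inverse (1 - (S.proj x - S.proj y)) (S.s y v)) := by
  obtain ⟨u, rfl⟩ := (S.transport h).surjective v
  rw [LinearEquiv.symm_apply_apply, transport_apply, S.inverse_apply_transport h]

end FDSubbundle.WeightedSummand

end Transport

section Pullback

variable {B : Type u} [TopologicalSpace B] {𝕜 : Type} [RCLike 𝕜]
  {F : Type*} [NormedAddCommGroup F] [NormedSpace 𝕜 F] {𝓕 : B → Type v}
  [∀ x, AddCommGroup (𝓕 x)] [∀ x, Module 𝕜 (𝓕 x)] [TopologicalSpace (TotalSpace F 𝓕)]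
  [∀ x, TopologicalSpace (𝓕 x)] [FiberBundle F 𝓕] [VectorBundle 𝕜 F 𝓕]
  {B' : Type*} [TopologicalSpace B']

omit [TopologicalSpace B] [∀ x, AddCommGroup (𝓕 x)] [∀ x, TopologicalSpace (𝓕 x)] [NormedAddCommGroup F] in
theorem continuousAt_totalSpace_pullback {f : B' → B} {T : Type*} [TopologicalSpace T]
    {b : T → B'} {t₀ : T} {y : ∀ t, 𝓕 (f (b t))} (hb : ContinuousAt b t₀)
    (hy : ContinuousAt (fun t => (⟨f (b t), y t⟩ : TotalSpace F 𝓕)) t₀) :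
    ContinuousAt (fun t => (⟨b t, y t⟩ : TotalSpace F (f *ᵖ 𝓕))) t₀ :=
  (inducing_pullbackTotalSpaceEmbedding F 𝓕 f).continuousAt_iff.2 (hb.prodMk hy)

namespace FDSubbundle

/-- The pullback of a finite-dimensional subbundle. -/
def pullback (V : FDSubbundle 𝕜 F 𝓕) (f : C(B', B)) :
    FDSubbundle 𝕜 F ((f : B' → B) *ᵖ 𝓕) where
  carrier x := V.carrier (f x)
  isFDSubbundle := isFDSubbundle_of_exists_frame fun x₀ => by
    obtain ⟨n, g, hg⟩ := V.isFDSubbundle.exists_frame (f x₀)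
    refine ⟨n, fun i x => g i (f x), ?_⟩
    filter_upwards [f.continuous.continuousAt.eventually hg] with x hx
    exact ⟨fun i => continuousAt_totalSpace_pullback (b := id) continuousAt_id
      ((hx.continuousAt i).comp f.continuous.continuousAt), hx.linearIndependent, hx.span_eq⟩

theorem continuous_pullback_lift (V : FDSubbundle 𝕜 F 𝓕) (f : C(B', B)) :
    Continuous fun p : TotalSpace Unit (V.pullback f).toBundle.fiber =>
      (⟨f p.proj, p.snd⟩ : TotalSpace Unit V.toBundle.fiber) :=
  V.continuous_toBundle ((Pullback.continuous_lift F 𝓕 f).comp (V.pullback f).continuous_inclusion)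

theorem continuous_pullback_mk (V : FDSubbundle 𝕜 F 𝓕) (f : C(B', B)) {T : Type*}
    [TopologicalSpace T] {b : T → B'} {s : ∀ t, V.carrier (f (b t))} (hb : Continuous b)
    (hs : Continuous fun t => (⟨f (b t), (s t : 𝓕 (f (b t)))⟩ : TotalSpace F 𝓕)) :
    Continuous fun t => (⟨b t, s t⟩ : TotalSpace Unit (V.pullback f).toBundle.fiber) :=
  (V.pullback f).continuous_toBundle (continuous_iff_continuousAt.2 fun _ =>
    continuousAt_totalSpace_pullback hb.continuousAt hs.continuousAt)

/-- Pullbacks along maps for which the idempotents are close are isomorphic. -/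
theorem isIso_pullback_of_norm_lt {V : FDSubbundle 𝕜 F 𝓕} (S : V.WeightedSummand 1)
    {f f' : C(B', B)} (h : ∀ x, ‖S.proj (f x) - S.proj (f' x)‖ < 1) :
    FDBundle.IsIso (V.pullback f).toBundle (V.pullback f').toBundle := by
  have hp : Continuous fun p : TotalSpace Unit (V.pullback f).toBundle.fiber => p.proj :=
    (V.pullback f).toBundle.locallyTrivial.1
  have hp' : Continuous fun p : TotalSpace Unit (V.pullback f').toBundle.fiber => p.proj :=
    (V.pullback f').toBundle.locallyTrivial.1
  refine ⟨fun x => S.transport (h x), V.continuous_pullback_mk f' hp ?_,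
    V.continuous_pullback_mk f hp' ?_⟩
  · exact S.continuous_q.comp ((f'.continuous.comp hp).prodMk
      (S.continuous_s.comp (V.continuous_pullback_lift f)))
  · have h1 : Continuous fun x => Ring.inverse (1 - (S.proj (f x) - S.proj (f' x))) := by
      refine continuous_iff_continuousAt.2 fun x => ContinuousAt.comp (g := Ring.inverse) ?_
        (continuous_const.sub ((S.continuous_proj.comp f.continuous).sub
          (S.continuous_proj.comp f'.continuous))).continuousAt
      obtain ⟨w, hw⟩ := isUnit_one_sub_of_norm_lt_one (h x)
      rw [← hw]
      exact NormedRing.inverse_continuousAt w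
    refine (S.continuous_q.comp ((f.continuous.comp hp').prodMk ((h1.comp hp').clm_apply
      (S.continuous_s.comp (V.continuous_pullback_lift f'))))).congr fun p => ?_
    exact congrArg (fun v : V.carrier (f p.proj) => (⟨f p.proj, v⟩ : TotalSpace F 𝓕))
      (S.transport_symm_apply (h p.proj) p.snd).symm

end FDSubbundle

end Pullback

section Homotopy

variable {X : Type u} [TopologicalSpace X] [CompactSpace X] [T2Space X] {𝕜 : Type} [RCLike 𝕜]
  {F : Type*} [NormedAddCommGroup F] [NormedSpace 𝕜 F] {𝓕 : X × I → Type v}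
  [∀ p, AddCommGroup (𝓕 p)] [∀ p, Module 𝕜 (𝓕 p)] [TopologicalSpace (TotalSpace F 𝓕)]
  [∀ p, TopologicalSpace (𝓕 p)] [FiberBundle F 𝓕] [VectorBundle 𝕜 F 𝓕]

/-- Homotopy invariance of finite-dimensional subbundles. -/
theorem FDSubbundle.isIso_pullback_sliceInclusion (V : FDSubbundle 𝕜 F 𝓕) (t t' : I) :
    FDBundle.IsIso (V.pullback (sliceInclusion X t)).toBundle
      (V.pullback (sliceInclusion X t')).toBundle := by
  obtain ⟨S⟩ := V.nonempty_weightedSummand_one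
  refine isPreconnected_univ.induction₂ (fun t t' =>
    FDBundle.IsIso (V.pullback (sliceInclusion X t)).toBundle
      (V.pullback (sliceInclusion X t')).toBundle) (fun t _ => ?_)
    (fun _ _ _ _ _ _ => FDBundle.IsIso.trans) (fun _ _ _ _ => FDBundle.IsIso.symm)
    (Set.mem_univ t) (Set.mem_univ t')
  have hO : IsOpen {q : X × I | ‖S.proj (q.1, t) - S.proj q‖ < 1} :=
    isOpen_lt (((S.continuous_proj.comp (by fun_prop)).sub S.continuous_proj).norm) continuous_const
  obtain ⟨u, v, -, hv, hu, h0, huv⟩ := generalized_tube_lemma (isCompact_univ (X := X))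
    (isCompact_singleton (x := t)) hO (by
      rintro ⟨x, t⟩ ⟨-, rfl⟩
      simp)
  rw [nhdsWithin_univ]
  filter_upwards [hv.mem_nhds (h0 rfl)] with t' ht'
  refine FDSubbundle.isIso_pullback_of_norm_lt S fun x => ?_
  have h1 : (x, t') ∈ {q : X × I | ‖S.proj (q.1, t) - S.proj q‖ < 1} :=
    huv (Set.mk_mem_prod (hu trivial) ht')
  exact h1

end Homotopy

theorem mainTheorem6 {X : Type u} [TopologicalSpace X] [CompactSpace X] [T2Space X]
    {𝕜 : Type} [RCLike 𝕜]
    {E : Type*} [NormedAddCommGroup E] [NormedSpace 𝕜 E] [CompleteSpace E]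
    {𝓔 : X × I → Type v} [∀ p, AddCommGroup (𝓔 p)] [∀ p, Module 𝕜 (𝓔 p)]
    [TopologicalSpace (TotalSpace E 𝓔)] [∀ p, TopologicalSpace (𝓔 p)]
    [FiberBundle E 𝓔] [VectorBundle 𝕜 E 𝓔]
    {F : Type*} [NormedAddCommGroup F] [NormedSpace 𝕜 F] [CompleteSpace F]
    {𝓕 : X × I → Type v} [∀ p, AddCommGroup (𝓕 p)] [∀ p, Module 𝕜 (𝓕 p)]
    [TopologicalSpace (TotalSpace F 𝓕)] [∀ p, TopologicalSpace (𝓕 p)]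
    [FiberBundle F 𝓕] [VectorBundle 𝕜 F 𝓕]
    [∀ p, IsTopologicalAddGroup (𝓕 p)] [∀ p, ContinuousSMul 𝕜 (𝓕 p)]
    (L : BanachBundleHom 𝕜 E 𝓔 F 𝓕) (hL : L.IsFredholm) :
    (L.pullback (sliceInclusion X 0)).IsIndexBundle (L.pullback (sliceInclusion X 0)).ind ∧
    (L.pullback (sliceInclusion X 1)).IsIndexBundle (L.pullback (sliceInclusion X 1)).ind ∧
    (L.pullback (sliceInclusion X 0)).ind = (L.pullback (sliceInclusion X 1)).ind := by
  have hind : ∀ t, (L.pullback (sliceInclusion X t)).IsIndexBundle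
      (L.pullback (sliceInclusion X t)).ind := fun t =>
    BanachBundleHom.isIndexBundle_ind (BanachBundleHom.exists_isIndexBundle
      (hL.imp fun _ hk x => hk (x, t)))
  refine ⟨hind 0, hind 1, ?_⟩
  obtain ⟨V, hV⟩ := BanachBundleHom.exists_isTransversal hL
  let W : FDSubbundle 𝕜 E 𝓔 := ⟨L.preimage V, BanachBundleHom.isFDSubbundle_preimage
    (fun x => (hL.choose_spec x).1.finite_ker) V hV⟩
  have hslice : ∀ t, (L.pullback (sliceInclusion X t)).ind =
      KGroup.ofBundle (W.pullback (sliceInclusion X t)).toBundle -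
        KGroup.ofBundle (V.pullback (sliceInclusion X t)).toBundle := fun t =>
    ((hind t).2 (V.pullback (sliceInclusion X t)) fun x => hV (x, t)).choose_spec
  have hclass : ∀ {A A' : FDBundle.{u, v} X 𝕜}, A.IsIso A' →
      KGroup.ofBundle A = KGroup.ofBundle A' := fun h =>
    congrArg Algebra.GrothendieckAddGroup.of (Quotient.sound h)
  rw [hslice 0, hslice 1, hclass (W.isIso_pullback_sliceInclusion 0 1),
    hclass (V.isIso_pullback_sliceInclusion 0 1)]
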